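/- Let $(A,B)\in\mathbb{R}^{n\times n}\times\mathbb{R}^{n\times m}$ be stabilizable, i.e. all eigenvalues of $A+BF$ have negative real part for some $F\in\mathbb{R}^{m\times n}$. For $x_0\in\mathbb{R}^n$, let $\mathcal{U}(x_0)$ be the set of all $u\in L^2([0,\infty),\mathbb{R}^m)$ for which the solution of $\dot x(t)=Ax(t)+Bu(t)$, $x(0)=x_0$, satisfies $\lim_{t\to\infty}x(t)=0$, and consider the problem $$\min_{u\in\mathcal{U}(x_0)}\ \eta(u):=\int_0^\infty\|u(t)\|^2\,dt .$$ Let $P\in\mathbb{C}^{n\times n}$ be any invertible matrix such that $P^{-1}AP=\begin{bmatrix}J_u&0\\0&J_s\end{bmatrix}$, where the eigenvalues of $J_u$ have positive real parts and those of $J_s$ have nonpositive real parts (for instance a Jordan normal form of $A$ with suitably ordered blocks). Let $C_u$ be the block of rows of $P^{-1}B$ that corresponds to $J_u$, and put $$W_u:=\int_0^\infty e^{-J_ut}C_uC_u^\dagger e^{-J_u^\dagger t}\,dt,\qquad K:=(P^{-1})^\dagger\begin{bmatrix}W_u^{-1}&0\\0&0\end{bmatrix}P^{-1}.$$ Let $V_a\subseteq\mathbb{C}^n$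 be the complex span of the generalized eigenvectors of $A-BB^\top K$ for the eigenvalues with negative real part. Then such a $P$ exists, and $K$ is real and does not depend on the choice of $P$; $V_a$ has a basis of real vectors, and the real span $R_a\subseteq\mathbb{R}^n$ of such a basis does not depend on the basis. For every $x_0\in\mathbb{R}^n$, the problem has a solution (i.e. the minimum is attained) if and only if $x_0\in R_a$. If $x_0\in R_a$, then the minimum is $x_0^\top Kx_0$, and it is attained by exactly one control $u^*\in\mathcal{U}(x_0)$ (up to equality almost everywhere), which is given by $u^*(t)=-B^\top Kx(t)$ for $t\ge0$, where $x$ is the solution generated by $u^*$ from $x_0$. -/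

import Mathlib

open MeasureTheory Filter Topology

noncomputable section

namespace MinEnergy

/-- The complex matrix with the same (real) entries. -/
def toComplex {ι κ : Type*} (M : Matrix ι κ ℝ) : Matrix ι κ ℂ :=
  M.map (fun r : ℝ => (r : ℂ))

/-- A real square matrix is Hurwitz if all its complex eigenvalues have negative real part. -/
def IsHurwitz {n : ℕ} (M : Matrix (Fin n) (Fin n) ℝ) : Prop :=
  ∀ μ ∈ spectrum ℂ (toComplex M), μ.re < 0

/-- `(A, B)` is stabilizable: `A + B F` is Hurwitz for some real feedback matrix `F`. -/
def IsStabilizable {n m : ℕ} (A : Matrix (Fin n) (Fin n) ℝ) (B : Matrix (Fin n) (Fin m) ℝ) :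
    Prop :=
  ∃ F : Matrix (Fin m) (Fin n) ℝ, IsHurwitz (A + B * F)

/-! ### The control problem, with real controls -/

/-- `x` is the (Caratheodory) solution on `[0, ∞)` of `x' = A x + B u`, `x(0) = x₀`,
in integrated form. Values at negative times play no role. -/
def IsTrajectory {n m : ℕ} (A : Matrix (Fin n) (Fin n) ℝ) (B : Matrix (Fin n) (Fin m) ℝ)
    (x₀ : Fin n → ℝ) (u : ℝ → EuclideanSpace ℝ (Fin m)) (x : ℝ → Fin n → ℝ) : Prop :=
  ContinuousOn x (Set.Ici 0) ∧
    ∀ t : ℝ, 0 ≤ t → x t = x₀ + ∫ s in (0 : ℝ)..t, (A.mulVec (x s) + B.mulVec (u s).ofLp)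

/-- The set `𝒰(x₀)` of admissible controls: square integrable on `[0, ∞)`, and the solution
generated from `x₀` tends to `0`. -/
def admissible {n m : ℕ} (A : Matrix (Fin n) (Fin n) ℝ) (B : Matrix (Fin n) (Fin m) ℝ)
    (x₀ : Fin n → ℝ) : Set (ℝ → EuclideanSpace ℝ (Fin m)) :=
  {u | MemLp u 2 (volume.restrict (Set.Ici (0 : ℝ))) ∧
    ∃ x : ℝ → Fin n → ℝ, IsTrajectory A B x₀ u x ∧ Tendsto x atTop (𝓝 0)}

/-- The energy `η(u) = ∫₀^∞ ‖u(t)‖² dt` (Euclidean norm). -/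
def energy {m : ℕ} (u : ℝ → EuclideanSpace ℝ (Fin m)) : ℝ :=
  ∫ t in Set.Ici (0 : ℝ), ‖u t‖ ^ 2

/-- `u` solves the infinite-horizon minimum energy control problem from `x₀`. -/
def IsMinimizer {n m : ℕ} (A : Matrix (Fin n) (Fin n) ℝ) (B : Matrix (Fin n) (Fin m) ℝ)
    (x₀ : Fin n → ℝ) (u : ℝ → EuclideanSpace ℝ (Fin m)) : Prop :=
  u ∈ admissible A B x₀ ∧ ∀ v ∈ admissible A B x₀, energy u ≤ energy v

/-! ### The matrix `K` and the space `V_a` -/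

/-- The infinite-horizon controllability Gramian `∫₀^∞ e^{-Jt} C C† e^{-J† t} dt`,
computed entrywise. -/
def gramian {k m : ℕ} (J : Matrix (Fin k) (Fin k) ℂ) (C : Matrix (Fin k) (Fin m) ℂ) :
    Matrix (Fin k) (Fin k) ℂ :=
  Matrix.of fun i j => ∫ t in Set.Ici (0 : ℝ),
    (NormedSpace.exp (-(t : ℂ) • J) * C * C.conjTranspose *
      NormedSpace.exp (-(t : ℂ) • J.conjTranspose)) i j

/-- `K = (P⁻¹)† diag(W_u⁻¹, 0) P⁻¹`, where `P⁻¹ A P = diag(J_u, J_s)`, the eigenvalues of `J_u`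
have positive and those of `J_s` nonpositive real parts, and `W_u` is the infinite-horizon
Gramian of `(J_u, C_u)`, with `C_u` the upper block of `P⁻¹ B`. Here `Q` is `P⁻¹`.
(Every Jordan normal form of `A`, with its blocks suitably ordered, is such a `diag(J_u, J_s)`.) -/
def IsRiccatiMatrix {n m : ℕ} (A : Matrix (Fin n) (Fin n) ℂ) (B : Matrix (Fin n) (Fin m) ℂ)
    (K : Matrix (Fin n) (Fin n) ℂ) : Prop :=
  ∃ (nu ns : ℕ) (P : Matrix (Fin n) (Fin nu ⊕ Fin ns) ℂ) (Q : Matrix (Fin nu ⊕ Fin ns) (Fin n) ℂ)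
    (Ju : Matrix (Fin nu) (Fin nu) ℂ) (Js : Matrix (Fin ns) (Fin ns) ℂ),
    P * Q = 1 ∧ Q * P = 1 ∧
    Q * A * P = Matrix.fromBlocks Ju 0 0 Js ∧
    (∀ μ ∈ spectrum ℂ Ju, 0 < μ.re) ∧
    (∀ μ ∈ spectrum ℂ Js, μ.re ≤ 0) ∧
    K = Q.conjTranspose *
      (Matrix.fromBlocks (gramian Ju (Q * B).toRows₁)⁻¹ 0 0 0 :
        Matrix (Fin nu ⊕ Fin ns) (Fin nu ⊕ Fin ns) ℂ) * Q

/-- The complex span of the generalized right eigenvectors of `M` for the eigenvalues with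
negative real part. The space `V_a` is this span for `M = A - B B† K`. -/
def stableSubspace {n : ℕ} (M : Matrix (Fin n) (Fin n) ℂ) : Submodule ℂ (Fin n → ℂ) :=
  ⨆ (μ : ℂ) (_ : μ.re < 0), Module.End.maxGenEigenspace (Matrix.toLin' M) μ

/-- `R` is the real span of a complex basis of `V` that consists of real vectors. -/
def IsRealSpanOfRealBasis {n : ℕ} (V : Submodule ℂ (Fin n → ℂ)) (R : Submodule ℝ (Fin n → ℝ)) :
    Prop :=
  ∃ (k : ℕ) (b : Fin k → Fin n → ℝ),
    LinearIndependent ℂ (fun i : Fin k => fun j : Fin n => (b i j : ℂ)) ∧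
    Submodule.span ℂ (Set.range (fun i : Fin k => fun j : Fin n => (b i j : ℂ))) = V ∧
    R = Submodule.span ℝ (Set.range b)

end MinEnergy

end

namespace MinEnergy

open scoped Matrix

/-! ### The flow of a linear system with constant coefficients -/

section Flow

variable {𝕜 ι : Type*} [RCLike 𝕜] [Fintype ι] [DecidableEq ι]

/-! The Gramian `W` of the unstable part satisfies the Lyapunov equation `J W + W Jᴴ = C Cᴴ`
(`gramian_lyapunov`). Stabilizability is used through the Hautus test: no left eigenvector of `A`
with eigenvalue in the open right half-plane is orthogonal to `B`. This makes `W` invertible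
(`IsSplitting.gramian_isUnit`). Multiplying the Lyapunov equation by `W⁻¹` on both sides gives the
Riccati equation `Aᵀ K + K A = K B Bᵀ K`, and the closed loop `A - B Bᵀ K` has its spectrum in the
closed left half-plane (`IsRiccatiMatrix.spectrum_closedLoop`). Two splittings of `A` differ by a
block diagonal change of basis, so `K` is unique; the conjugate splitting then shows that `K` is
real.

Completing the square with the Riccati equation gives, for every admissible `u`, `energy u = x₀ᵀ K
x₀ + ∫ |u + Bᵀ K x|²`. Hence `x₀ᵀ K x₀` is a lower bound, and a control attains it only if it is the
feedback `-Bᵀ K x`. If the closed-loop flow from `x₀` tends to zero, it does so exponentially, so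
the feedback is square integrable, admissible and optimal.

For the converse, a minimizer is not assumed to reach the lower bound. Its first variation yields an
adjoint state `p` with `p' = -Aᵀ p`, `p → 0` and `u = -Bᵀ p` (`IsMinimizer.exists_adjoint`). By the
Riccati equation `q = p - K x` solves `q' = -(A - B Bᵀ K)ᵀ q`, and `q → 0`. This system has no
eigenvalue in the open left half-plane, so `q = 0`. The minimizer is therefore the feedback, and its
trajectory, which tends to zero, is the closed-loop flow from `x₀`.

The stable subspace enters only through its dynamical description as the set of initial values with
flow tending to zero (`flowStable_eq_spectralSubspace`). That description is compatible with real
and imaginary parts, which gives the real form `Ra`. -/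

theorem hasDerivAt_exp_smul (N : Matrix ι ι 𝕜) (t : ℝ) :
    HasDerivAt (fun s : ℝ => NormedSpace.exp (s • N)) (N * NormedSpace.exp (t • N)) t := by
  let _ : NormedRing (Matrix ι ι 𝕜) := Matrix.linftyOpNormedRing
  let _ : NormedAlgebra ℝ (Matrix ι ι 𝕜) := Matrix.linftyOpNormedAlgebra
  let _ : NormedAlgebra ℚ (Matrix ι ι 𝕜) := NormedAlgebra.restrictScalars ℚ ℝ _
  exact hasDerivAt_exp_smul_const' (𝕂 := ℝ) N t

theorem exp_add_smul (N : Matrix ι ι 𝕜) (s t : ℝ) :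
    NormedSpace.exp ((s + t) • N) = NormedSpace.exp (s • N) * NormedSpace.exp (t • N) := by
  rw [add_smul]
  exact Matrix.exp_add_of_commute _ _ (((Commute.refl N).smul_left s).smul_right t)

theorem exp_smul_mul_exp_neg_smul (N : Matrix ι ι 𝕜) (t : ℝ) :
    NormedSpace.exp (t • N) * NormedSpace.exp ((-t) • N) = 1 := by
  rw [← exp_add_smul]; simp

theorem exp_neg_smul_mul_exp_smul (N : Matrix ι ι 𝕜) (t : ℝ) :
    NormedSpace.exp ((-t) • N) * NormedSpace.exp (t • N) = 1 := by
  rw [← exp_add_smul]; simp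

theorem commute_exp_smul (N : Matrix ι ι 𝕜) (t : ℝ) :
    N * NormedSpace.exp (t • N) = NormedSpace.exp (t • N) * N := by
  let _ : NormedRing (Matrix ι ι 𝕜) := Matrix.linftyOpNormedRing
  let _ : NormedAlgebra ℝ (Matrix ι ι 𝕜) := Matrix.linftyOpNormedAlgebra
  let _ : NormedAlgebra ℚ (Matrix ι ι 𝕜) := NormedAlgebra.restrictScalars ℚ ℝ _
  exact (((Commute.refl N).smul_right t).exp_right)

/-- The solution of `y' = N y`, `y(0) = x`. -/
noncomputable def flow (N : Matrix ι ι 𝕜) (x : ι → 𝕜) (t : ℝ) : ι → 𝕜 :=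
  NormedSpace.exp (t • N) *ᵥ x

theorem flow_zero (N : Matrix ι ι 𝕜) (x : ι → 𝕜) : flow N x 0 = x := by
  simp [flow]

theorem flow_add (N : Matrix ι ι 𝕜) (x y : ι → 𝕜) (t : ℝ) :
    flow N (x + y) t = flow N x t + flow N y t := by
  simp [flow, Matrix.mulVec_add]

theorem flow_smul (N : Matrix ι ι 𝕜) (c : 𝕜) (x : ι → 𝕜) (t : ℝ) :
    flow N (c • x) t = c • flow N x t := by
  simp [flow, Matrix.mulVec_smul]

theorem flow_mulVec (N : Matrix ι ι 𝕜) (x : ι → 𝕜) (t : ℝ) :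
    flow N (N *ᵥ x) t = N *ᵥ flow N x t := by
  simp [flow, commute_exp_smul]

omit [DecidableEq ι] in
theorem HasDerivAt.mulVec {F : ℝ → Matrix ι ι 𝕜} {F' : Matrix ι ι 𝕜} {t : ℝ}
    (h : HasDerivAt F F' t) (x : ι → 𝕜) :
    HasDerivAt (fun s => F s *ᵥ x) (F' *ᵥ x) t := by
  rw [hasDerivAt_pi]
  intro i
  have h1 : ∀ j, HasDerivAt (fun s => F s i j * x j) (F' i j * x j) t := fun j =>
    ((hasDerivAt_pi.1 (hasDerivAt_pi.1 h i)) j).mul_const (x j)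
  simpa [Matrix.mulVec, dotProduct] using HasDerivAt.fun_sum (fun j _ => h1 j)

theorem hasDerivAt_flow (N : Matrix ι ι 𝕜) (x : ι → 𝕜) (t : ℝ) :
    HasDerivAt (flow N x) (N *ᵥ flow N x t) t := by
  have := HasDerivAt.mulVec (hasDerivAt_exp_smul N t) x
  rw [← Matrix.mulVec_mulVec] at this
  exact this

theorem continuous_flow (N : Matrix ι ι 𝕜) (x : ι → 𝕜) : Continuous (flow N x) :=
  continuous_iff_continuousAt.2 fun t => (hasDerivAt_flow N x t).continuousAt

theorem continuous_exp_smul (N : Matrix ι ι 𝕜) :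
    Continuous (fun t : ℝ => NormedSpace.exp (t • N)) :=
  continuous_matrix fun i j => continuous_iff_continuousAt.2 fun t =>
    (hasDerivAt_pi.1 (hasDerivAt_pi.1 (hasDerivAt_exp_smul N t) i) j).continuousAt

/-- The scalar part `μ` and `N - μ` commute, so the exponential factors; applied to `x`, the series
of the second factor stops after `k` terms. -/
theorem flow_eq_of_sub_pow (N : Matrix ι ι 𝕜) (μ : 𝕜) (k : ℕ) (x : ι → 𝕜)
    (hx : ((N - μ • (1 : Matrix ι ι 𝕜)) ^ k) *ᵥ x = 0) (t : ℝ) :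
    flow N x t = NormedSpace.exp (t • μ) • ∑ j ∈ Finset.range k,
      ((j.factorial : 𝕜)⁻¹ * (t : 𝕜) ^ j) • ((N - μ • (1 : Matrix ι ι 𝕜)) ^ j) *ᵥ x := by
  set M := N - μ • (1 : Matrix ι ι 𝕜) with hM
  have hN : t • N = t • (μ • (1 : Matrix ι ι 𝕜)) + t • M := by rw [← smul_add, hM]; simp
  have h1 : NormedSpace.exp (t • (μ • (1 : Matrix ι ι 𝕜)))
      = NormedSpace.exp (t • μ) • (1 : Matrix ι ι 𝕜) := by
    have : t • (μ • (1 : Matrix ι ι 𝕜)) = Matrix.diagonal (fun _ => t • μ) := by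
      rw [← smul_assoc, Matrix.smul_one_eq_diagonal]
    rw [this, Matrix.exp_diagonal, Matrix.smul_one_eq_diagonal]
    congr 1
    ext i
    simp [NormedSpace.exp_def, Pi.coe_exp]
  have h2 : NormedSpace.exp (t • M) *ᵥ x = ∑ j ∈ Finset.range k,
      ((j.factorial : 𝕜)⁻¹ * (t : 𝕜) ^ j) • (M ^ j) *ᵥ x := by
    let _ : NormedRing (Matrix ι ι 𝕜) := Matrix.linftyOpNormedRing
    let _ : NormedAlgebra ℝ (Matrix ι ι 𝕜) := Matrix.linftyOpNormedAlgebra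
    have hs := NormedSpace.exp_series_hasSum_exp' (𝕂 := ℝ) (t • M)
    have hs2 : HasSum (fun j : ℕ => ((j.factorial : ℝ)⁻¹ • (t • M) ^ j) *ᵥ x)
        (NormedSpace.exp (t • M) *ᵥ x) := by
      exact hs.map (Matrix.mulVec.addMonoidHomLeft x)
        (show Continuous fun A : Matrix ι ι 𝕜 => A *ᵥ x from
          continuous_id.matrix_mulVec continuous_const)
    have hs3 : ∀ j : ℕ, ((j.factorial : ℝ)⁻¹ • (t • M) ^ j) *ᵥ x
        = ((j.factorial : 𝕜)⁻¹ * (t : 𝕜) ^ j) • (M ^ j) *ᵥ x := by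
      intro j
      have : t • M = (t : 𝕜) • M := by ext; simp [RCLike.real_smul_eq_coe_mul]
      have h' : ((j.factorial : ℝ)⁻¹ • (t • M) ^ j)
          = ((j.factorial : 𝕜)⁻¹ * (t : 𝕜) ^ j) • (M ^ j) := by
        rw [this, smul_pow, mul_smul]
        ext; simp [RCLike.real_smul_eq_coe_mul]
      rw [h', Matrix.smul_mulVec]
    simp_rw [hs3] at hs2
    refine hs2.unique (hasSum_sum_of_ne_finset_zero fun j hj => ?_)
    obtain ⟨i, rfl⟩ := Nat.exists_eq_add_of_le (not_lt.1 fun h => hj (Finset.mem_range.2 h))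
    rw [add_comm k i, pow_add M, ← Matrix.mulVec_mulVec, hx]
    simp
  rw [flow, hN, Matrix.exp_add_of_commute, ← Matrix.mulVec_mulVec, h2, h1]
  · simp [Matrix.smul_mulVec]
  · exact ((Commute.one_left M).smul_left μ).smul_left t |>.smul_right t

end Flow

/-! ### Exponential decay -/

section Decay

variable {E : Type*} [NormedAddCommGroup E]

/-- `f` decays exponentially on `[0, ∞)`. -/
def ExpDecay (f : ℝ → E) : Prop :=
  ∃ C c : ℝ, 0 < c ∧ ∀ t : ℝ, 0 ≤ t → ‖f t‖ ≤ C * Real.exp (-c * t)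

theorem ExpDecay.zero : ExpDecay (fun _ => (0 : E)) :=
  ⟨0, 1, one_pos, fun t _ => by simp⟩

theorem ExpDecay.add {f g : ℝ → E} (hf : ExpDecay f) (hg : ExpDecay g) :
    ExpDecay (fun t => f t + g t) := by
  obtain ⟨C, c, hc, h⟩ := hf
  obtain ⟨D, d, hd, k⟩ := hg
  refine ⟨|C| + |D|, min c d, lt_min hc hd, fun t ht => ?_⟩
  have h1 : Real.exp (-c * t) ≤ Real.exp (-(min c d) * t) :=
    Real.exp_le_exp.2 (by nlinarith [min_le_left c d])
  have h2 : Real.exp (-d * t) ≤ Real.exp (-(min c d) * t) :=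
    Real.exp_le_exp.2 (by nlinarith [min_le_right c d])
  calc ‖f t + g t‖ ≤ ‖f t‖ + ‖g t‖ := norm_add_le _ _
    _ ≤ C * Real.exp (-c * t) + D * Real.exp (-d * t) := add_le_add (h t ht) (k t ht)
    _ ≤ |C| * Real.exp (-c * t) + |D| * Real.exp (-d * t) := by
        gcongr <;> exact le_abs_self _
    _ ≤ |C| * Real.exp (-(min c d) * t) + |D| * Real.exp (-(min c d) * t) := by gcongr
    _ = _ := by ring

theorem ExpDecay.sum {κ : Type*} (s : Finset κ) {f : κ → ℝ → E} (h : ∀ i ∈ s, ExpDecay (f i)) :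
    ExpDecay (fun t => ∑ i ∈ s, f i t) := by
  classical
  induction s using Finset.induction_on with
  | empty => simpa using ExpDecay.zero
  | insert a s ha ih =>
    simp_rw [Finset.sum_insert ha]
    exact (h a (Finset.mem_insert_self a s)).add
      (ih fun i hi => h i (Finset.mem_insert_of_mem hi))

theorem ExpDecay.of_norm_le {F : Type*} [NormedAddCommGroup F] {f : ℝ → E} {g : ℝ → F}
    (hg : ExpDecay g) (M : ℝ) (h : ∀ t, 0 ≤ t → ‖f t‖ ≤ M * ‖g t‖) : ExpDecay f := by
  obtain ⟨C, c, hc, hC⟩ := hg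
  refine ⟨|M| * C, c, hc, fun t ht => ?_⟩
  calc ‖f t‖ ≤ M * ‖g t‖ := h t ht
    _ ≤ |M| * ‖g t‖ := by gcongr; exact le_abs_self M
    _ ≤ |M| * (C * Real.exp (-c * t)) := by gcongr; exact hC t ht
    _ = _ := by ring

theorem ExpDecay.tendsto {f : ℝ → E} (h : ExpDecay f) : Tendsto f atTop (𝓝 0) := by
  obtain ⟨C, c, hc, hC⟩ := h
  refine squeeze_zero_norm' ((eventually_ge_atTop 0).mono hC) ?_
  have : Tendsto (fun t : ℝ => Real.exp (-c * t)) atTop (𝓝 0) :=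
    Real.tendsto_exp_atBot.comp (tendsto_id.const_mul_atTop_of_neg (by linarith))
  simpa using this.const_mul C

theorem ExpDecay.mul {R : Type*} [NormedRing R] {f g : ℝ → R} (hf : ExpDecay f)
    (hg : ExpDecay g) : ExpDecay (fun t => f t * g t) := by
  obtain ⟨C, c, hc, h⟩ := hf
  obtain ⟨D, d, hd, k⟩ := hg
  refine ⟨C * D, c + d, by positivity, fun t ht => ?_⟩
  have h1 := h t ht
  have h2 := k t ht
  calc ‖f t * g t‖ ≤ ‖f t‖ * ‖g t‖ := norm_mul_le _ _
    _ ≤ (C * Real.exp (-c * t)) * (D * Real.exp (-d * t)) :=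
        mul_le_mul h1 h2 (norm_nonneg _) ((norm_nonneg _).trans h1)
    _ = C * D * Real.exp (-(c + d) * t) := by
        rw [show -(c + d) * t = -c * t + -d * t by ring, Real.exp_add]; ring

theorem ExpDecay.integrableOn [NormedSpace ℝ E] {f : ℝ → E} (h : ExpDecay f)
    (hf : AEStronglyMeasurable f (volume.restrict (Set.Ici (0 : ℝ)))) :
    IntegrableOn f (Set.Ici 0) := by
  obtain ⟨C, c, hc, hC⟩ := h
  have h1 : IntegrableOn (fun t : ℝ => C * Real.exp (-c * t)) (Set.Ici 0) := by
    rw [integrableOn_Ici_iff_integrableOn_Ioi]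
    exact (exp_neg_integrableOn_Ioi 0 hc).const_mul C
  refine Integrable.mono' h1 hf ?_
  filter_upwards [ae_restrict_mem measurableSet_Ici] with t ht using hC t ht

theorem expDecay_pow_mul_exp {μ : ℂ} (hμ : μ.re < 0) (j : ℕ) (c : ℂ) :
    ExpDecay (fun t : ℝ => NormedSpace.exp (t • μ) * (c * (t : ℂ) ^ j)) := by
  -- Half of the decay rate pays for the power of `t`; the other half remains as the rate of decay.
  set a := -μ.re / 2 with ha
  have ha0 : 0 < a := by rw [ha]; linarith
  refine ⟨‖c‖ * (j.factorial / a ^ j), a, ha0, fun t ht => ?_⟩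
  have h1 : ‖NormedSpace.exp (t • μ)‖ = Real.exp (-a * t) * Real.exp (-(a * t)) := by
    rw [← Complex.exp_eq_exp_ℂ, Complex.norm_exp, ← Real.exp_add]
    congr 1
    simp [ha]; ring
  have h2 : t ^ j ≤ j.factorial / a ^ j * Real.exp (a * t) := by
    have := Real.pow_div_factorial_le_exp (a * t) (by positivity) j
    rw [div_le_iff₀ (by positivity), mul_pow] at this
    rw [div_mul_eq_mul_div, le_div_iff₀ (by positivity)]
    linarith
  rw [norm_mul, norm_mul, norm_pow, Complex.norm_real, Real.norm_of_nonneg ht, h1]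
  calc Real.exp (-a * t) * Real.exp (-(a * t)) * (‖c‖ * t ^ j)
      ≤ Real.exp (-a * t) * Real.exp (-(a * t)) *
        (‖c‖ * (j.factorial / a ^ j * Real.exp (a * t))) := by gcongr
    _ = ‖c‖ * (j.factorial / a ^ j) * Real.exp (-a * t) *
        (Real.exp (-(a * t)) * Real.exp (a * t)) := by ring
    _ = _ := by rw [← Real.exp_add]; simp

end Decay

/-! ### Spectral subspaces -/

section Spectral

variable {V : Type*} [AddCommGroup V] [Module ℂ V]

/-- The sum of the generalized eigenspaces for the eigenvalues in `S`. -/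
def spectralSubspace (f : Module.End ℂ V) (S : Set ℂ) : Submodule ℂ V :=
  ⨆ (μ : ℂ) (_ : μ ∈ S), Module.End.maxGenEigenspace f μ

theorem isCompl_spectralSubspace [FiniteDimensional ℂ V] (f : Module.End ℂ V) (S : Set ℂ) :
    IsCompl (spectralSubspace f S) (spectralSubspace f Sᶜ) := by
  constructor
  · exact (Module.End.independent_maxGenEigenspace f).disjoint_biSup_biSup disjoint_compl_right
  · rw [codisjoint_iff, ← top_le_iff, ← Module.End.iSup_maxGenEigenspace_eq_top f]
    refine iSup_le fun μ => ?_
    by_cases h : μ ∈ S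
    · exact le_sup_of_le_left (le_iSup₂_of_le μ h le_rfl)
    · exact le_sup_of_le_right (le_iSup₂_of_le (f := fun μ (_ : μ ∈ Sᶜ) => f.maxGenEigenspace μ)
        μ h le_rfl)

theorem spectralSubspace_invariant (f : Module.End ℂ V) (S : Set ℂ) {x : V}
    (hx : x ∈ spectralSubspace f S) : f x ∈ spectralSubspace f S := by
  have : spectralSubspace f S ≤ (spectralSubspace f S).comap f := by
    refine iSup₂_le fun μ hμ y hy => ?_
    have h1 : f y ∈ f.maxGenEigenspace μ :=
      Module.End.mapsTo_maxGenEigenspace_of_comm (Commute.refl f) μ hy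
    exact (le_iSup₂_of_le (f := fun μ (_ : μ ∈ S) => f.maxGenEigenspace μ) μ hμ le_rfl) h1
  exact this hx

theorem mem_of_eigenvector_mem_spectralSubspace [FiniteDimensional ℂ V] {f : Module.End ℂ V} {S : Set ℂ} {μ : ℂ} {x : V}
    (hx : x ∈ spectralSubspace f S) (hx0 : x ≠ 0) (h : f x = μ • x) : μ ∈ S := by
  by_contra hμ
  have h1 : x ∈ f.maxGenEigenspace μ :=
    Module.End.eigenspace_le_maxGenEigenspace (Module.End.mem_eigenspace_iff.2 h)
  have h2 : x ∈ spectralSubspace f Sᶜ :=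
    (le_iSup₂_of_le (f := fun μ (_ : μ ∈ Sᶜ) => f.maxGenEigenspace μ) μ hμ le_rfl) h1
  exact hx0 ((Submodule.disjoint_def.1 (isCompl_spectralSubspace f S).disjoint) x hx h2)

theorem exists_eigenvector_mem [FiniteDimensional ℂ V] {f : Module.End ℂ V} {p : Submodule ℂ V} (hp : p ≠ ⊥)
    (hf : ∀ x ∈ p, f x ∈ p) : ∃ x ∈ p, x ≠ 0 ∧ ∃ μ : ℂ, f x = μ • x := by
  have : Nontrivial p := Submodule.nontrivial_iff_ne_bot.2 hp
  obtain ⟨μ, hμ⟩ := Module.End.exists_eigenvalue (f.restrict hf)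
  obtain ⟨v, hv⟩ := hμ.exists_hasEigenvector
  refine ⟨v, v.2, fun h => hv.2 (Subtype.ext h), μ, ?_⟩
  simpa using congrArg Subtype.val hv.apply_eq_smul

end Spectral

/-! ### Stable subspaces of complex matrix flows. -/

section Stable

variable {ι : Type*} [Fintype ι] [DecidableEq ι]

theorem mem_spectrum_iff_exists_mulVec {N : Matrix ι ι ℂ} {μ : ℂ} :
    μ ∈ spectrum ℂ N ↔ ∃ x, x ≠ 0 ∧ N *ᵥ x = μ • x := by
  rw [← Matrix.spectrum_toLin', ← Module.End.hasEigenvalue_iff_mem_spectrum]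
  constructor
  · intro h
    obtain ⟨v, hv⟩ := h.exists_hasEigenvector
    exact ⟨v, hv.2, by simpa using hv.apply_eq_smul⟩
  · rintro ⟨x, hx, h⟩
    exact Module.End.hasEigenvalue_of_hasEigenvector (x := x)
      ⟨Module.End.mem_eigenspace_iff.2 (by simpa using h), hx⟩

theorem flow_of_eigenvector {N : Matrix ι ι ℂ} {μ : ℂ} {x : ι → ℂ} (h : N *ᵥ x = μ • x) (t : ℝ) :
    flow N x t = NormedSpace.exp (t • μ) • x := by
  have := flow_eq_of_sub_pow N μ 1 x (by simp [Matrix.sub_mulVec, Matrix.smul_mulVec, h]) t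
  simpa using this

theorem expDecay_flow_of_mem_maxGenEigenspace {N : Matrix ι ι ℂ} {μ : ℂ} (hμ : μ.re < 0)
    {x : ι → ℂ} (hx : x ∈ Module.End.maxGenEigenspace (Matrix.toLin' N) μ) : ExpDecay (flow N x) := by
  obtain ⟨k, hk⟩ := (Module.End.mem_maxGenEigenspace _ _ _).1 hx
  have hk' : ((N - μ • (1 : Matrix ι ι ℂ)) ^ k) *ᵥ x = 0 := by
    have : (Matrix.toLin' N - μ • (1 : Module.End ℂ (ι → ℂ))) ^ k
        = Matrix.toLin' ((N - μ • (1 : Matrix ι ι ℂ)) ^ k) := by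
      rw [Matrix.toLin'_pow]; simp [Module.End.one_eq_id]
    rw [this, Matrix.toLin'_apply] at hk
    exact hk
  have h1 : flow N x = fun t : ℝ => ∑ j ∈ Finset.range k,
      (NormedSpace.exp (t • μ) * ((j.factorial : ℂ)⁻¹ * (t : ℂ) ^ j)) •
        ((N - μ • (1 : Matrix ι ι ℂ)) ^ j) *ᵥ x := by
    funext t
    rw [flow_eq_of_sub_pow N μ k x hk' t, Finset.smul_sum]
    simp [smul_smul]
  rw [h1]
  refine ExpDecay.sum _ fun j _ => ?_
  refine (expDecay_pow_mul_exp hμ j (j.factorial : ℂ)⁻¹).of_norm_le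
    ‖((N - μ • (1 : Matrix ι ι ℂ)) ^ j) *ᵥ x‖ fun t _ => ?_
  rw [norm_smul, mul_comm]

theorem expDecay_flow_of_mem_spectralSubspace {N : Matrix ι ι ℂ} {x : ι → ℂ}
    (hx : x ∈ spectralSubspace (Matrix.toLin' N) {μ | μ.re < 0}) : ExpDecay (flow N x) := by
  let p : Submodule ℂ (ι → ℂ) :=
    { carrier := {x | ExpDecay (flow N x)}
      zero_mem' := by
        have : flow N (0 : ι → ℂ) = fun _ => 0 := by funext t; simp [flow]
        simpa [this] using ExpDecay.zero
      add_mem' := fun {x y} hx hy => by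
        have : flow N (x + y) = fun t => flow N x t + flow N y t := funext (flow_add N x y)
        simpa [this] using ExpDecay.add hx hy
      smul_mem' := fun c x hx => by
        refine ExpDecay.of_norm_le hx ‖c‖ fun t _ => ?_
        rw [flow_smul, norm_smul] }
  have : spectralSubspace (Matrix.toLin' N) {μ | μ.re < 0} ≤ p :=
    iSup₂_le fun μ hμ y hy => expDecay_flow_of_mem_maxGenEigenspace hμ hy
  exact this hx

theorem eigenvalue_re_neg_of_tendsto {N : Matrix ι ι ℂ} {μ : ℂ} {x : ι → ℂ} (hx : x ≠ 0)
    (h : N *ᵥ x = μ • x) (ht : Tendsto (flow N x) atTop (𝓝 0)) : μ.re < 0 := by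
  by_contra hμ
  have h1 : ∀ᶠ t : ℝ in atTop, ‖x‖ ≤ ‖flow N x t‖ := by
    filter_upwards [eventually_ge_atTop 0] with t ht0
    rw [flow_of_eigenvector h, norm_smul, ← Complex.exp_eq_exp_ℂ, Complex.norm_exp]
    refine le_mul_of_one_le_left (norm_nonneg _) (Real.one_le_exp ?_)
    simpa using mul_nonneg ht0 (not_lt.1 hμ)
  have h2 := le_of_tendsto_of_tendsto tendsto_const_nhds ht.norm h1
  exact hx (by simpa using h2)

/-- The initial values from which the flow tends to zero. -/
def flowStable (N : Matrix ι ι ℂ) : Submodule ℂ (ι → ℂ) where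
  carrier := {x | Tendsto (flow N x) atTop (𝓝 0)}
  zero_mem' := by
    have : flow N (0 : ι → ℂ) = fun _ => 0 := by funext t; simp [flow]
    simp [this]
  add_mem' := fun {x y} hx hy => by
    have : flow N (x + y) = fun t => flow N x t + flow N y t := funext (flow_add N x y)
    simpa [this] using Tendsto.add hx hy
  smul_mem' := fun c x hx => by
    have : flow N (c • x) = fun t => c • flow N x t := funext (flow_smul N c x)
    simpa [this] using Tendsto.const_smul hx c

theorem mem_flowStable {N : Matrix ι ι ℂ} {x : ι → ℂ} :
    x ∈ flowStable N ↔ Tendsto (flow N x) atTop (𝓝 0) := Iff.rfl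

theorem mulVec_mem_flowStable {N : Matrix ι ι ℂ} {x : ι → ℂ} (hx : x ∈ flowStable N) :
    N *ᵥ x ∈ flowStable N := by
  rw [mem_flowStable] at *
  have : flow N (N *ᵥ x) = fun t => N *ᵥ flow N x t := funext (flow_mulVec N x)
  rw [this]
  have hc : Continuous fun y : ι → ℂ => N *ᵥ y := continuous_const.matrix_mulVec continuous_id
  have h0 := (hc.tendsto 0).comp hx
  rw [Matrix.mulVec_zero] at h0
  exact h0

/-- For the nontrivial inclusion: if the invariant space `flowStable N` met the complementary
spectral subspace, the intersection would contain an eigenvector with `0 ≤ μ.re`, and the flow from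
it does not shrink. Subtracting the stable component of a vector of `flowStable N` leaves an element
of this intersection. -/
theorem flowStable_eq_spectralSubspace (N : Matrix ι ι ℂ) :
    flowStable N = spectralSubspace (Matrix.toLin' N) {μ | μ.re < 0} := by
  have hle : spectralSubspace (Matrix.toLin' N) {μ | μ.re < 0} ≤ flowStable N :=
    fun x hx => (expDecay_flow_of_mem_spectralSubspace hx).tendsto
  refine le_antisymm ?_ hle
  set S : Set ℂ := {μ | μ.re < 0} with hS
  have hbot : flowStable N ⊓ spectralSubspace (Matrix.toLin' N) Sᶜ = ⊥ := by
    by_contra hne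
    obtain ⟨x, hx, hx0, μ, hμ⟩ := exists_eigenvector_mem (f := Matrix.toLin' N) hne
      fun x hx => ⟨by simpa using mulVec_mem_flowStable hx.1, spectralSubspace_invariant _ _ hx.2⟩
    exact mem_of_eigenvector_mem_spectralSubspace hx.2 hx0 hμ
      (eigenvalue_re_neg_of_tendsto hx0 (by simpa using hμ) hx.1)
  intro x hx
  have hx' : x ∈ spectralSubspace (Matrix.toLin' N) S ⊔ spectralSubspace (Matrix.toLin' N) Sᶜ := by
    rw [(isCompl_spectralSubspace _ S).sup_eq_top]; trivial
  obtain ⟨y, hy, z, hz, rfl⟩ := Submodule.mem_sup.1 hx'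
  have hz0 : z ∈ flowStable N := by
    simpa using (flowStable N).sub_mem hx (hle hy)
  have : z ∈ flowStable N ⊓ spectralSubspace (Matrix.toLin' N) Sᶜ := ⟨hz0, hz⟩
  rw [hbot, Submodule.mem_bot] at this
  simpa [this] using hy

/-- Mere convergence becomes an exponential rate, even if `N` also has eigenvalues outside the open
left half-plane; this is what makes the feedback control square integrable. -/
theorem expDecay_flow_of_tendsto {N : Matrix ι ι ℂ} {x : ι → ℂ}
    (h : Tendsto (flow N x) atTop (𝓝 0)) : ExpDecay (flow N x) :=
  expDecay_flow_of_mem_spectralSubspace (flowStable_eq_spectralSubspace N ▸ mem_flowStable.2 h)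

theorem expDecay_flow_of_spectrum {N : Matrix ι ι ℂ} (h : ∀ μ ∈ spectrum ℂ N, μ.re < 0)
    (x : ι → ℂ) : ExpDecay (flow N x) := by
  apply expDecay_flow_of_mem_spectralSubspace
  set S : Set ℂ := {μ | μ.re < 0} with hS
  have hbot : spectralSubspace (Matrix.toLin' N) Sᶜ = ⊥ := by
    by_contra hne
    obtain ⟨x, hx, hx0, μ, hμ⟩ := exists_eigenvector_mem (f := Matrix.toLin' N) hne
      fun x hx => spectralSubspace_invariant _ _ hx
    exact mem_of_eigenvector_mem_spectralSubspace hx hx0 hμ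
      (h μ (mem_spectrum_iff_exists_mulVec.2 ⟨x, hx0, by simpa using hμ⟩))
  have := (isCompl_spectralSubspace (Matrix.toLin' N) S).sup_eq_top
  rw [hbot, sup_bot_eq] at this
  rw [this]; trivial

/-- A nonzero invariant space `flowStable N` would contain an eigenvector, whose eigenvalue must
have negative real part. Imaginary eigenvalues are allowed, as the closed loop may have them. -/
theorem eq_zero_of_tendsto_flow {N : Matrix ι ι ℂ} (h : ∀ μ ∈ spectrum ℂ N, 0 ≤ μ.re)
    {x : ι → ℂ} (hx : Tendsto (flow N x) atTop (𝓝 0)) : x = 0 := by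
  by_contra hx0
  obtain ⟨y, hy, hy0, μ, hμ⟩ := exists_eigenvector_mem (f := Matrix.toLin' N)
    (p := flowStable N) (fun hb => hx0 (by
      have : x ∈ flowStable N := hx
      simpa [hb] using this))
    fun x hx => by simpa using mulVec_mem_flowStable hx
  have hμ' : N *ᵥ y = μ • y := by simpa using hμ
  exact absurd (eigenvalue_re_neg_of_tendsto hy0 hμ' hy)
    (not_lt.2 (h μ (mem_spectrum_iff_exists_mulVec.2 ⟨y, hy0, hμ'⟩)))

end Stable

theorem flowStable_eq_stableSubspace {n : ℕ} (N : Matrix (Fin n) (Fin n) ℂ) :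
    flowStable N = stableSubspace N :=
  flowStable_eq_spectralSubspace N

/-! ### Sylvester and Lyapunov equations -/

section Sylvester

variable {ι κ : Type*} [Fintype ι] [DecidableEq ι] [Fintype κ] [DecidableEq κ]

theorem aeval_mul_eq_mul_aeval {J : Matrix ι ι ℂ} {L : Matrix κ κ ℂ} {X : Matrix ι κ ℂ}
    (h : J * X = X * L) (p : Polynomial ℂ) :
    Polynomial.aeval J p * X = X * Polynomial.aeval L p := by
  have hpow : ∀ k : ℕ, J ^ k * X = X * L ^ k := by
    intro k
    induction k with
    | zero => simp
    | succ k ih => rw [pow_succ, Matrix.mul_assoc, h, ← Matrix.mul_assoc, ih, Matrix.mul_assoc,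
        ← pow_succ]
  induction p using Polynomial.induction_on' with
  | add p q hp hq => simp [Matrix.add_mul, Matrix.mul_add, hp, hq]
  | monomial k c =>
    rw [← Polynomial.C_mul_X_pow_eq_monomial]
    simp [← Algebra.smul_def, hpow]

/-- A Sylvester equation `J X = X L` with disjoint spectra has only the trivial solution. -/
theorem eq_zero_of_mul_eq_mul {J : Matrix ι ι ℂ} {L : Matrix κ κ ℂ} {X : Matrix ι κ ℂ}
    (h : J * X = X * L) (hs : ∀ μ ∈ spectrum ℂ J, μ ∉ spectrum ℂ L) : X = 0 := by
  cases isEmpty_or_nonempty ι with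
  | inl hι => ext i; exact isEmptyElim i
  | inr hι =>
    -- By Cayley–Hamilton the characteristic polynomial of `L` kills the right side, while its value
    -- at `J` is invertible by spectral mapping, since none of its roots lies in the spectrum of
    -- `J`.
    have h1 := aeval_mul_eq_mul_aeval h L.charpoly
    rw [Matrix.aeval_self_charpoly, Matrix.mul_zero] at h1
    have hu : IsUnit (Polynomial.aeval J L.charpoly) := by
      by_contra hn
      have h0 : (0 : ℂ) ∈ spectrum ℂ (Polynomial.aeval J L.charpoly) :=
        spectrum.zero_mem_iff ℂ |>.2 hn
      rw [spectrum.map_polynomial_aeval_of_nonempty J _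
        (spectrum.nonempty_of_isAlgClosed_of_finiteDimensional ℂ J)] at h0
      obtain ⟨μ, hμ, h0⟩ := h0
      exact hs μ hμ (Matrix.mem_spectrum_of_isRoot_charpoly h0)
    obtain ⟨Z, -, hZ⟩ := isUnit_iff_exists.1 hu
    calc X = Z * (Polynomial.aeval J L.charpoly * X) := by
          rw [← Matrix.mul_assoc, hZ, Matrix.one_mul]
      _ = 0 := by rw [h1, Matrix.mul_zero]

theorem re_pos_of_mem_spectrum_conjTranspose {J : Matrix ι ι ℂ}
    (hJ : ∀ μ ∈ spectrum ℂ J, 0 < μ.re) : ∀ μ ∈ spectrum ℂ Jᴴ, 0 < μ.re := by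
  intro μ hμ
  rw [← Matrix.star_eq_conjTranspose, spectrum.map_star] at hμ
  simpa using hJ _ hμ

theorem re_neg_of_mem_spectrum_neg {J : Matrix ι ι ℂ}
    (hJ : ∀ μ ∈ spectrum ℂ J, 0 < μ.re) : ∀ μ ∈ spectrum ℂ (-J), μ.re < 0 := by
  intro μ hμ
  rw [← spectrum.neg_eq] at hμ
  simpa using hJ _ hμ

/-- The difference solves a Sylvester equation between `J` and `-Jᴴ`, whose spectra lie in opposite
open half-planes. Identities between Gramians can thus be proved without returning to the integral.
-/
theorem lyapunov_unique {J W W' : Matrix ι ι ℂ} (hJ : ∀ μ ∈ spectrum ℂ J, 0 < μ.re)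
    (h : J * W + W * Jᴴ = J * W' + W' * Jᴴ) : W = W' := by
  have h1 : J * (W - W') = (W - W') * (-Jᴴ) := by
    rw [Matrix.mul_sub, Matrix.mul_neg, Matrix.sub_mul, neg_sub]
    rw [sub_eq_sub_iff_add_eq_add, h, add_comm]
  refine sub_eq_zero.1 (eq_zero_of_mul_eq_mul h1 fun μ h2 h3 => ?_)
  have := re_neg_of_mem_spectrum_neg (re_pos_of_mem_spectrum_conjTranspose hJ) μ h3
  exact lt_asymm this (hJ μ h2)

end Sylvester

/-! ### The Gramian -/

section Gramian

variable {k m : ℕ}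

theorem expDecay_exp_smul_apply {ι : Type*} [Fintype ι] [DecidableEq ι] {N : Matrix ι ι ℂ}
    (h : ∀ μ ∈ spectrum ℂ N, μ.re < 0) (i j : ι) :
    ExpDecay (fun t : ℝ => NormedSpace.exp (t • N) i j) := by
  refine (expDecay_flow_of_spectrum h (Pi.single j 1)).of_norm_le 1 fun t _ => ?_
  have : NormedSpace.exp (t • N) i j = flow N (Pi.single j 1) t i := by simp [flow]
  rw [this, one_mul]
  exact norm_le_pi_norm _ i

/-- The integrand `G` satisfies `G' = -(J G + G Jᴴ)`, starts at `C Cᴴ` and decays exponentially;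
integrate over the half-line. -/
theorem gramian_lyapunov {J : Matrix (Fin k) (Fin k) ℂ} (C : Matrix (Fin k) (Fin m) ℂ)
    (hJ : ∀ μ ∈ spectrum ℂ J, 0 < μ.re) :
    J * gramian J C + gramian J C * Jᴴ = C * Cᴴ := by
  set E : ℝ → Matrix (Fin k) (Fin k) ℂ := fun t => NormedSpace.exp (t • (-J)) with hE
  set G : ℝ → Matrix (Fin k) (Fin k) ℂ := fun t => E t * (C * Cᴴ) * (E t)ᴴ with hG
  have hEd : ∀ t i j, HasDerivAt (fun s => E s i j) ((-(J * E t)) i j) t := fun t i j => by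
    have := hasDerivAt_pi.1 (hasDerivAt_pi.1 (hasDerivAt_exp_smul (-J) t) i) j
    rw [Matrix.neg_mul] at this
    exact this
  have hGapply : ∀ t i j, G t i j = ∑ b, (∑ a, E t i a * (C * Cᴴ) a b) * star (E t j b) := by
    intro t i j
    simp [hG, Matrix.mul_apply]
  have hgram : ∀ i j, gramian J C i j = ∫ t in Set.Ioi (0 : ℝ), G t i j := by
    intro i j
    rw [gramian, Matrix.of_apply, integral_Ici_eq_integral_Ioi]
    refine setIntegral_congr_fun measurableSet_Ioi fun t _ => ?_
    have h1 : (-(t : ℂ)) • J = t • (-J) := by ext; simp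
    have h2 : (-(t : ℂ)) • Jᴴ = (t • (-J))ᴴ := by ext; simp
    simp only [hG, hE]
    rw [h2, h1, Matrix.exp_conjTranspose, Matrix.mul_assoc _ C]
  have hdecay : ∀ i j, ExpDecay (fun t => G t i j) := by
    have hEdec : ∀ i j, ExpDecay (fun t => E t i j) := fun i j =>
      expDecay_exp_smul_apply (re_neg_of_mem_spectrum_neg hJ) i j
    intro i j
    simp_rw [hGapply]
    refine ExpDecay.sum _ fun b _ => ExpDecay.mul (ExpDecay.sum _ fun a _ => ?_) ?_
    · refine (hEdec i a).of_norm_le ‖(C * Cᴴ) a b‖ fun t _ => ?_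
      rw [norm_mul, mul_comm]
    · exact (hEdec j b).of_norm_le 1 fun t _ => by simp
  have hderiv : ∀ t i j, HasDerivAt (fun s => G s i j) (-(J * G t + G t * Jᴴ) i j) t := by
    intro t i j
    have h1 : HasDerivAt (fun s => ∑ b, (∑ a, E s i a * (C * Cᴴ) a b) * star (E s j b))
        (∑ b, ((∑ a, (-(J * E t)) i a * (C * Cᴴ) a b) * star (E t j b) +
          (∑ a, E t i a * (C * Cᴴ) a b) * star ((-(J * E t)) j b))) t :=
      HasDerivAt.fun_sum fun b _ => (HasDerivAt.fun_sum fun a _ =>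
        (hEd t i a).mul_const _).mul (hEd t j b).star
    have h2 : -(J * G t + G t * Jᴴ)
        = (-(J * E t)) * (C * Cᴴ) * (E t)ᴴ + E t * (C * Cᴴ) * (-(J * E t))ᴴ := by
      simp only [hG, Matrix.conjTranspose_neg, Matrix.conjTranspose_mul, Matrix.neg_mul,
        Matrix.mul_neg, Matrix.mul_assoc, neg_add]
    have h3 : (-(J * G t + G t * Jᴴ)) i j
        = ∑ b, ((∑ a, (-(J * E t)) i a * (C * Cᴴ) a b) * star (E t j b) +
          (∑ a, E t i a * (C * Cᴴ) a b) * star ((-(J * E t)) j b)) := by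
      rw [h2, Matrix.add_apply, Finset.sum_add_distrib]
      congr 1
    rw [← Matrix.neg_apply, h3]
    simp_rw [hGapply]
    exact h1
  have hcont : ∀ i j, Continuous fun t => G t i j := fun i j =>
    continuous_iff_continuousAt.2 fun t => (hderiv t i j).continuousAt
  have hint : ∀ i j, IntegrableOn (fun t => G t i j) (Set.Ioi 0) := fun i j =>
    ((hdecay i j).integrableOn (hcont i j).aestronglyMeasurable).mono_set Set.Ioi_subset_Ici_self
  have hsum : ∀ t i j, (J * G t + G t * Jᴴ) i j
      = ∑ a, J i a * G t a j + ∑ a, G t i a * Jᴴ a j := fun t i j => by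
    simp [Matrix.mul_apply]
  have hint1 : ∀ i j, IntegrableOn (fun t => ∑ a, J i a * G t a j) (Set.Ioi 0) := fun i j =>
    integrable_finsetSum _ fun a _ => (hint a j).const_mul _
  have hint2 : ∀ i j, IntegrableOn (fun t => ∑ a, G t i a * Jᴴ a j) (Set.Ioi 0) := fun i j =>
    integrable_finsetSum _ fun a _ => (hint i a).mul_const _
  ext i j
  have hFTC := integral_Ioi_of_hasDerivAt_of_tendsto (a := 0) (f := fun t => G t i j)
    (f' := fun t => -(J * G t + G t * Jᴴ) i j) (m := 0)
    (hcont i j).continuousWithinAt (fun t _ => hderiv t i j)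
    (by simp_rw [hsum]; exact ((hint1 i j).add (hint2 i j)).neg) (hdecay i j).tendsto
  rw [integral_neg, zero_sub, neg_inj] at hFTC
  have hG0 : G 0 i j = (C * Cᴴ) i j := by simp [hG, hE]
  rw [← hG0, ← hFTC]
  simp_rw [hsum]
  rw [integral_add (hint1 i j) (hint2 i j), integral_finsetSum _ fun a _ => (hint a j).const_mul _,
    integral_finsetSum _ fun a _ => (hint i a).mul_const _]
  simp_rw [integral_const_mul, integral_mul_const, ← hgram]
  simp [Matrix.mul_apply]

/-- The adjoint of the Gramian solves the same Lyapunov equation. -/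
theorem isHermitian_gramian {J : Matrix (Fin k) (Fin k) ℂ} (C : Matrix (Fin k) (Fin m) ℂ)
    (hJ : ∀ μ ∈ spectrum ℂ J, 0 < μ.re) : (gramian J C)ᴴ = gramian J C := by
  apply lyapunov_unique hJ
  have := congrArg Matrix.conjTranspose (gramian_lyapunov C hJ)
  simp only [Matrix.conjTranspose_add, Matrix.conjTranspose_mul,
    Matrix.conjTranspose_conjTranspose] at this
  rw [gramian_lyapunov C hJ, ← this, add_comm]

end Gramian

/-! ### Splitting off the unstable part -/

section Splitting

theorem exists_basis_of_isCompl {E : Type*} [AddCommGroup E] [Module ℂ E] [FiniteDimensional ℂ E]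
    {U V : Submodule ℂ E} (h : IsCompl U V) :
    ∃ (nu ns : ℕ) (b : Module.Basis (Fin nu ⊕ Fin ns) ℂ E),
      (∀ j, b (Sum.inl j) ∈ U) ∧ (∀ j, b (Sum.inr j) ∈ V) ∧
      (∀ x ∈ U, ∀ i, b.repr x (Sum.inr i) = 0) ∧ (∀ x ∈ V, ∀ i, b.repr x (Sum.inl i) = 0) := by
  let bU := Module.finBasis ℂ U
  let bV := Module.finBasis ℂ V
  refine ⟨_, _, (bU.prod bV).map (Submodule.prodEquivOfIsCompl U V h), fun j => ?_, fun j => ?_,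
    fun x hx i => ?_, fun x hx i => ?_⟩
  · simp
  · simp
  · have := Submodule.prodEquivOfIsCompl_symm_apply_left U V h ⟨x, hx⟩
    rw [Module.Basis.map_repr, LinearEquiv.trans_apply]
    erw [this]
    simp
  · have := Submodule.prodEquivOfIsCompl_symm_apply_right U V h ⟨x, hx⟩
    rw [Module.Basis.map_repr, LinearEquiv.trans_apply]
    erw [this]
    simp

/-- Choose a basis adapted to the two complementary spectral subspaces. An eigenvector of a diagonal
block, extended by zero, is an eigenvector of `A` inside the matching subspace, which locates its
eigenvalue. -/
theorem exists_splitting {n : ℕ} (A : Matrix (Fin n) (Fin n) ℂ) :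
    ∃ (nu ns : ℕ) (P : Matrix (Fin n) (Fin nu ⊕ Fin ns) ℂ)
      (Q : Matrix (Fin nu ⊕ Fin ns) (Fin n) ℂ)
      (Ju : Matrix (Fin nu) (Fin nu) ℂ) (Js : Matrix (Fin ns) (Fin ns) ℂ),
      P * Q = 1 ∧ Q * P = 1 ∧ Q * A * P = Matrix.fromBlocks Ju 0 0 Js ∧
      (∀ μ ∈ spectrum ℂ Ju, 0 < μ.re) ∧ (∀ μ ∈ spectrum ℂ Js, μ.re ≤ 0) := by
  set f := Matrix.toLin' A with hf
  set S : Set ℂ := {μ | 0 < μ.re} with hS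
  set U := spectralSubspace f S
  set V := spectralSubspace f Sᶜ
  have hUV : IsCompl U V := isCompl_spectralSubspace f S
  obtain ⟨nu, ns, b, hbl, hbr, hrU, hrV⟩ := exists_basis_of_isCompl hUV
  let e := Pi.basisFun ℂ (Fin n)
  set P := e.toMatrix b with hP
  set Q := b.toMatrix e with hQ
  have hPQ : P * Q = 1 := by simp [hP, hQ]
  have hQP : Q * P = 1 := by simp [hP, hQ]
  have hA : Q * A * P = LinearMap.toMatrix b b f := by
    have h1 : LinearMap.toMatrix e e f = A := by
      rw [hf]; exact LinearMap.toMatrix'_toLin' A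
    rw [← h1, hP, hQ, basis_toMatrix_mul_linearMap_toMatrix_mul_basis_toMatrix]
  have h21 : ∀ i j, (Q * A * P) (Sum.inr i) (Sum.inl j) = 0 := by
    intro i j
    rw [hA, LinearMap.toMatrix_apply]
    exact hrU _ (spectralSubspace_invariant f S (hbl j)) i
  have h12 : ∀ i j, (Q * A * P) (Sum.inl i) (Sum.inr j) = 0 := by
    intro i j
    rw [hA, LinearMap.toMatrix_apply]
    exact hrV _ (spectralSubspace_invariant f Sᶜ (hbr j)) i
  have hblocks : Q * A * P
      = Matrix.fromBlocks (Q * A * P).toBlocks₁₁ 0 0 (Q * A * P).toBlocks₂₂ := by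
    conv_lhs => rw [← Matrix.fromBlocks_toBlocks (Q * A * P)]
    congr 1
    · ext i j; exact h12 i j
    · ext i j; exact h21 i j
  have hPmul : ∀ y, P *ᵥ y = ∑ j, y j • b j := by
    intro y
    ext i
    simp only [hP, e, Matrix.mulVec, dotProduct, Module.Basis.toMatrix_apply, Finset.sum_apply,
      Pi.smul_apply, smul_eq_mul, Pi.basisFun_repr]
    exact Finset.sum_congr rfl fun j _ => mul_comm _ _
  have hPinj : ∀ y, P *ᵥ y = 0 → y = 0 := fun y hy => by
    have := congrArg (Q *ᵥ ·) hy
    simpa [hQP] using this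
  have hAP : A * P = P * (Q * A * P) := by
    rw [← Matrix.mul_assoc, ← Matrix.mul_assoc, hPQ, Matrix.one_mul]
  refine ⟨_, _, P, Q, _, _, hPQ, hQP, hblocks, ?_, ?_⟩
  · intro μ hμ
    obtain ⟨y, hy0, hy⟩ := mem_spectrum_iff_exists_mulVec.1 hμ
    have hmem : P *ᵥ Sum.elim y 0 ∈ U := by
      rw [hPmul]
      simp only [Fintype.sum_sum_type, Sum.elim_inl, Sum.elim_inr, Pi.zero_apply, zero_smul,
        Finset.sum_const_zero, add_zero]
      exact U.sum_mem fun j _ => U.smul_mem _ (hbl j)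
    refine mem_of_eigenvector_mem_spectralSubspace (S := S) hmem (fun h => hy0 ?_) (μ := μ) ?_
    · have := hPinj _ h
      ext i; exact congrFun this (Sum.inl i)
    · rw [hf, Matrix.toLin'_apply, Matrix.mulVec_mulVec, hAP, ← Matrix.mulVec_mulVec, hblocks,
        Matrix.fromBlocks_mulVec, ← Matrix.mulVec_smul]
      congr 1
      ext (i | i) <;> simp [hy]
  · intro μ hμ
    obtain ⟨y, hy0, hy⟩ := mem_spectrum_iff_exists_mulVec.1 hμ
    have hmem : P *ᵥ Sum.elim 0 y ∈ V := by
      rw [hPmul]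
      simp only [Fintype.sum_sum_type, Sum.elim_inl, Sum.elim_inr, Pi.zero_apply, zero_smul,
        Finset.sum_const_zero, zero_add]
      exact V.sum_mem fun j _ => V.smul_mem _ (hbr j)
    refine not_lt.1 (mem_of_eigenvector_mem_spectralSubspace (S := Sᶜ) hmem
      (fun h => hy0 ?_) (μ := μ) ?_)
    · have := hPinj _ h
      ext i; exact congrFun this (Sum.inr i)
    · rw [hf, Matrix.toLin'_apply, Matrix.mulVec_mulVec, hAP, ← Matrix.mulVec_mulVec, hblocks,
        Matrix.fromBlocks_mulVec, ← Matrix.mulVec_smul]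
      congr 1
      ext (i | i) <;> simp [hy]

end Splitting

/-! ### The Riccati matrix -/

section Riccati

variable {n m : ℕ}

/-- No left eigenvector of `A` for an eigenvalue with positive real part is orthogonal to `B`. -/
def UnstableControllable (A : Matrix (Fin n) (Fin n) ℂ) (B : Matrix (Fin n) (Fin m) ℂ) : Prop :=
  ∀ (z : Fin n → ℂ) (μ : ℂ), Aᴴ *ᵥ z = μ • z → Bᴴ *ᵥ z = 0 → 0 < μ.re → z = 0

/-- `P⁻¹ A P = diag(Ju, Js)` with `Ju` antistable, `Js` without unstable eigenvalues, `Q = P⁻¹`. -/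
structure IsSplitting {nu ns : ℕ} (A : Matrix (Fin n) (Fin n) ℂ)
    (P : Matrix (Fin n) (Fin nu ⊕ Fin ns) ℂ) (Q : Matrix (Fin nu ⊕ Fin ns) (Fin n) ℂ)
    (Ju : Matrix (Fin nu) (Fin nu) ℂ) (Js : Matrix (Fin ns) (Fin ns) ℂ) : Prop where
  mul_inv : P * Q = 1
  inv_mul : Q * P = 1
  conj : Q * A * P = Matrix.fromBlocks Ju 0 0 Js
  re_pos : ∀ μ ∈ spectrum ℂ Ju, 0 < μ.re
  re_nonpos : ∀ μ ∈ spectrum ℂ Js, μ.re ≤ 0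

variable {A : Matrix (Fin n) (Fin n) ℂ} {B : Matrix (Fin n) (Fin m) ℂ}

namespace IsSplitting

variable {nu ns : ℕ} {P : Matrix (Fin n) (Fin nu ⊕ Fin ns) ℂ}
  {Q : Matrix (Fin nu ⊕ Fin ns) (Fin n) ℂ}
  {Ju : Matrix (Fin nu) (Fin nu) ℂ} {Js : Matrix (Fin ns) (Fin ns) ℂ}

theorem inv_mul_eq (h : IsSplitting A P Q Ju Js) : Q * A = Matrix.fromBlocks Ju 0 0 Js * Q := by
  rw [← h.conj, Matrix.mul_assoc (Q * A), h.mul_inv, Matrix.mul_one]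

theorem conjTranspose_mul_eq (h : IsSplitting A P Q Ju Js) :
    Aᴴ * Qᴴ = Qᴴ * Matrix.fromBlocks Juᴴ 0 0 Jsᴴ := by
  have := congrArg Matrix.conjTranspose h.inv_mul_eq
  simpa [Matrix.conjTranspose_mul, Matrix.fromBlocks_conjTranspose] using this

theorem eq_of_conjTranspose_mulVec_eq (h : IsSplitting A P Q Ju Js) {y z : Fin nu ⊕ Fin ns → ℂ}
    (hy : Qᴴ *ᵥ y = Qᴴ *ᵥ z) : y = z := by
  have h1 : Pᴴ * Qᴴ = 1 := by rw [← Matrix.conjTranspose_mul, h.inv_mul, Matrix.conjTranspose_one]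
  have := congrArg (Pᴴ *ᵥ ·) hy
  simpa [h1] using this

-- Testing the Lyapunov equation against `x` in the kernel of `W` gives `Cᴴ x = 0`, and then `W Jᴴ x
-- = 0`. So the kernel is invariant under `Jᴴ`; if nonzero, it contains an eigenvector of `Jᴴ`,
-- which lifts to an unstable left eigenvector of `A` orthogonal to `B`.
open scoped ComplexOrder in
theorem gramian_isUnit (h : IsSplitting A P Q Ju Js) (hAB : UnstableControllable A B) :
    IsUnit (gramian Ju (Q * B).toRows₁) := by
  set C := (Q * B).toRows₁ with hC
  set W := gramian Ju C with hW
  have hL : Ju * W + W * Juᴴ = C * Cᴴ := gramian_lyapunov C h.re_pos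
  have hH : Wᴴ = W := isHermitian_gramian C h.re_pos
  have hC0 : ∀ x, W *ᵥ x = 0 → Cᴴ *ᵥ x = 0 := by
    intro x hx
    have h2 : star x ᵥ* W = 0 := by
      have := congrArg star hx
      rwa [Matrix.star_mulVec, hH, star_zero] at this
    have h1 : star x ⬝ᵥ ((C * Cᴴ) *ᵥ x) = 0 := by
      rw [← hL, Matrix.add_mulVec, dotProduct_add, ← Matrix.mulVec_mulVec, hx,
        ← Matrix.mulVec_mulVec, Matrix.dotProduct_mulVec _ W, h2]
      simp
    rw [← Matrix.mulVec_mulVec, Matrix.dotProduct_mulVec] at h1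
    have h3 : star x ᵥ* C = star (Cᴴ *ᵥ x) := by
      rw [Matrix.star_mulVec, Matrix.conjTranspose_conjTranspose]
    rw [h3] at h1
    exact dotProduct_star_self_eq_zero.1 h1
  by_contra hu
  have hker : LinearMap.ker (Matrix.toLin' W) ≠ ⊥ := by
    intro hk
    apply hu
    rw [← Matrix.mulVec_injective_iff_isUnit]
    exact LinearMap.ker_eq_bot.1 hk
  obtain ⟨z, hz, hz0, μ, hμ⟩ := exists_eigenvector_mem (f := Matrix.toLin' Juᴴ) hker (by
    intro x hx
    have hx' : W *ᵥ x = 0 := by simpa using hx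
    have h1 : (Ju * W + W * Juᴴ) *ᵥ x = 0 := by
      rw [hL, ← Matrix.mulVec_mulVec, hC0 x hx', Matrix.mulVec_zero]
    rw [Matrix.add_mulVec, ← Matrix.mulVec_mulVec, hx', Matrix.mulVec_zero, zero_add] at h1
    simpa using h1)
  have hz' : W *ᵥ z = 0 := by simpa using hz
  have hμ' : Juᴴ *ᵥ z = μ • z := by simpa using hμ
  have hre : 0 < μ.re := re_pos_of_mem_spectrum_conjTranspose h.re_pos μ
    (mem_spectrum_iff_exists_mulVec.2 ⟨z, hz0, hμ'⟩)
  have h0 : Qᴴ *ᵥ Sum.elim z 0 = 0 := by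
    refine hAB _ μ ?_ ?_ hre
    · rw [Matrix.mulVec_mulVec, h.conjTranspose_mul_eq, ← Matrix.mulVec_mulVec,
        Matrix.fromBlocks_mulVec, ← Matrix.mulVec_smul]
      congr 1
      ext (i | i) <;> simp [hμ']
    · rw [Matrix.mulVec_mulVec, ← Matrix.conjTranspose_mul, ← Matrix.fromRows_toRows (Q * B),
        Matrix.conjTranspose_fromRows_eq_fromCols_conjTranspose, Matrix.fromCols_mulVec]
      simp [← hC, hC0 z hz']
  have h1 := h.eq_of_conjTranspose_mulVec_eq (y := Sum.elim z 0) (z := 0) (by simpa using h0)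
  apply hz0
  ext i
  exact congrFun h1 (Sum.inl i)

end IsSplitting

theorem isRiccatiMatrix_iff {K : Matrix (Fin n) (Fin n) ℂ} :
    IsRiccatiMatrix A B K ↔ ∃ (nu ns : ℕ) (P : Matrix (Fin n) (Fin nu ⊕ Fin ns) ℂ)
      (Q : Matrix (Fin nu ⊕ Fin ns) (Fin n) ℂ)
      (Ju : Matrix (Fin nu) (Fin nu) ℂ) (Js : Matrix (Fin ns) (Fin ns) ℂ),
      IsSplitting A P Q Ju Js ∧
      K = Qᴴ * (Matrix.fromBlocks (gramian Ju (Q * B).toRows₁)⁻¹ 0 0 0 :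
        Matrix (Fin nu ⊕ Fin ns) (Fin nu ⊕ Fin ns) ℂ) * Q := by
  constructor
  · rintro ⟨nu, ns, P, Q, Ju, Js, h1, h2, h3, h4, h5, h6⟩
    exact ⟨nu, ns, P, Q, Ju, Js, ⟨h1, h2, h3, h4, h5⟩, h6⟩
  · rintro ⟨nu, ns, P, Q, Ju, Js, ⟨h1, h2, h3, h4, h5⟩, h6⟩
    exact ⟨nu, ns, P, Q, Ju, Js, h1, h2, h3, h4, h5, h6⟩

theorem exists_isRiccatiMatrix (A : Matrix (Fin n) (Fin n) ℂ) (B : Matrix (Fin n) (Fin m) ℂ) :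
    ∃ K, IsRiccatiMatrix A B K := by
  obtain ⟨nu, ns, P, Q, Ju, Js, h1, h2, h3, h4, h5⟩ := exists_splitting A
  exact ⟨_, nu, ns, P, Q, Ju, Js, h1, h2, h3, h4, h5, rfl⟩

theorem IsRiccatiMatrix.isHermitian {K : Matrix (Fin n) (Fin n) ℂ} (hK : IsRiccatiMatrix A B K) :
    Kᴴ = K := by
  obtain ⟨nu, ns, P, Q, Ju, Js, h, rfl⟩ := isRiccatiMatrix_iff.1 hK
  simp [Matrix.conjTranspose_mul, Matrix.fromBlocks_conjTranspose, Matrix.conjTranspose_nonsing_inv,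
    isHermitian_gramian _ h.re_pos, Matrix.mul_assoc]

/-- On the unstable block this is the Lyapunov equation multiplied by `W⁻¹` from both sides; the
other blocks vanish, and congruence by `Q` returns to the original coordinates. -/
theorem IsRiccatiMatrix.riccati {K : Matrix (Fin n) (Fin n) ℂ} (hK : IsRiccatiMatrix A B K)
    (hAB : UnstableControllable A B) : Aᴴ * K + K * A = K * B * Bᴴ * K := by
  obtain ⟨nu, ns, P, Q, Ju, Js, h, rfl⟩ := isRiccatiMatrix_iff.1 hK
  have hu := h.gramian_isUnit hAB
  have hL := gramian_lyapunov (Q * B).toRows₁ h.re_pos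
  set C := (Q * B).toRows₁ with hC
  set W := gramian Ju C with hW
  have hW1 : W⁻¹ * W = 1 := Matrix.nonsing_inv_mul _ ((Matrix.isUnit_iff_isUnit_det _).1 hu)
  have hW2 : W * W⁻¹ = 1 := Matrix.mul_nonsing_inv _ ((Matrix.isUnit_iff_isUnit_det _).1 hu)
  set Λ : Matrix (Fin nu ⊕ Fin ns) (Fin nu ⊕ Fin ns) ℂ := Matrix.fromBlocks W⁻¹ 0 0 0 with hΛ
  have h11 : Juᴴ * W⁻¹ + W⁻¹ * Ju = W⁻¹ * (C * Cᴴ) * W⁻¹ := by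
    rw [← hL, Matrix.mul_add, Matrix.add_mul, ← Matrix.mul_assoc W⁻¹ W, hW1, Matrix.one_mul,
      Matrix.mul_assoc W⁻¹ (Ju * W), Matrix.mul_assoc Ju, hW2, Matrix.mul_one, add_comm]
  have hBB : Λ * ((Q * B) * (Q * B)ᴴ) * Λ = Matrix.fromBlocks (W⁻¹ * (C * Cᴴ) * W⁻¹) 0 0 0 := by
    rw [← Matrix.fromRows_toRows (Q * B), Matrix.conjTranspose_fromRows_eq_fromCols_conjTranspose,
      Matrix.fromRows_mul_fromCols, hΛ]
    simp [Matrix.fromBlocks_multiply, hC]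
  have hD : Matrix.fromBlocks Juᴴ 0 0 Jsᴴ * Λ + Λ * Matrix.fromBlocks Ju 0 0 Js
      = Λ * ((Q * B) * (Q * B)ᴴ) * Λ := by
    rw [hBB, ← h11, hΛ]
    simp [Matrix.fromBlocks_multiply, Matrix.fromBlocks_add]
  calc Aᴴ * (Qᴴ * Λ * Q) + Qᴴ * Λ * Q * A
      = (Aᴴ * Qᴴ) * Λ * Q + Qᴴ * Λ * (Q * A) := by simp only [Matrix.mul_assoc]
    _ = Qᴴ * (Matrix.fromBlocks Juᴴ 0 0 Jsᴴ * Λ + Λ * Matrix.fromBlocks Ju 0 0 Js) * Q := by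
        rw [h.conjTranspose_mul_eq, h.inv_mul_eq]
        simp only [Matrix.mul_assoc, Matrix.mul_add, Matrix.add_mul]
    _ = _ := by rw [hD]; simp only [Matrix.mul_assoc, Matrix.conjTranspose_mul]

/-- The Riccati equation reads `Aᴴ K = -K (A - B Bᴴ K)`, so `K` sends a closed-loop eigenvector `z`
for `μ` to zero or to an eigenvector of `Aᴴ` for `-μ`. In the latter case `-μ` belongs to `Juᴴ`, so
`μ.re < 0`. If `K z = 0`, the closed loop acts on `z` as `A`, the unstable coordinates of `z`
vanish, and `μ` belongs to `Js`. -/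
theorem IsRiccatiMatrix.spectrum_closedLoop {K : Matrix (Fin n) (Fin n) ℂ}
    (hK : IsRiccatiMatrix A B K) (hAB : UnstableControllable A B) :
    ∀ μ ∈ spectrum ℂ (A - B * Bᴴ * K), μ.re ≤ 0 := by
  have hARE := hK.riccati hAB
  obtain ⟨nu, ns, P, Q, Ju, Js, h, hKeq⟩ := isRiccatiMatrix_iff.1 hK
  have hu := h.gramian_isUnit hAB
  set W := gramian Ju (Q * B).toRows₁ with hW
  have hW2 : W * W⁻¹ = 1 := Matrix.mul_nonsing_inv _ ((Matrix.isUnit_iff_isUnit_det _).1 hu)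
  intro μ hμ
  obtain ⟨z, hz0, hz⟩ := mem_spectrum_iff_exists_mulVec.1 hμ
  set y := Q *ᵥ z with hy
  set v := W⁻¹ *ᵥ (y ∘ Sum.inl) with hv
  have hKz : K *ᵥ z = Qᴴ *ᵥ Sum.elim v 0 := by
    rw [hKeq, ← Matrix.mulVec_mulVec, ← Matrix.mulVec_mulVec, Matrix.fromBlocks_mulVec]
    simp [hv, hy]
  have hAK : Aᴴ *ᵥ (K *ᵥ z) = (-μ) • (K *ᵥ z) := by
    have h1 : Aᴴ * K = -(K * (A - B * Bᴴ * K)) := by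
      rw [Matrix.mul_sub, neg_sub, eq_sub_iff_add_eq, hARE]
      simp only [Matrix.mul_assoc]
    rw [Matrix.mulVec_mulVec, h1, Matrix.neg_mulVec, ← Matrix.mulVec_mulVec, hz,
      Matrix.mulVec_smul, neg_smul]
  have hJv : Juᴴ *ᵥ v = (-μ) • v := by
    rw [hKz, Matrix.mulVec_mulVec, h.conjTranspose_mul_eq, ← Matrix.mulVec_mulVec,
      ← Matrix.mulVec_smul] at hAK
    have h1 := h.eq_of_conjTranspose_mulVec_eq hAK
    rw [Matrix.fromBlocks_mulVec] at h1
    ext i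
    simpa using congrFun h1 (Sum.inl i)
  by_cases hv0 : v = 0
  · have hy1 : y ∘ Sum.inl = 0 := by
      have : W *ᵥ v = y ∘ Sum.inl := by rw [hv, Matrix.mulVec_mulVec, hW2, Matrix.one_mulVec]
      rw [← this, hv0, Matrix.mulVec_zero]
    have hKz0 : K *ᵥ z = 0 := by
      rw [hKz, hv0]; simp
    have hAz : A *ᵥ z = μ • z := by
      rw [← hz, Matrix.sub_mulVec, ← Matrix.mulVec_mulVec, hKz0]; simp
    have hDy : Matrix.fromBlocks Ju 0 0 Js *ᵥ y = μ • y := by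
      rw [hy, Matrix.mulVec_mulVec, ← h.inv_mul_eq, ← Matrix.mulVec_mulVec, hAz, Matrix.mulVec_smul]
    have hy2 : Js *ᵥ (y ∘ Sum.inr) = μ • (y ∘ Sum.inr) := by
      rw [Matrix.fromBlocks_mulVec] at hDy
      ext i
      simpa using congrFun hDy (Sum.inr i)
    refine h.re_nonpos μ (mem_spectrum_iff_exists_mulVec.2 ⟨_, fun h0 => hz0 ?_, hy2⟩)
    have hy0 : y = 0 := by
      ext (i | i)
      · exact congrFun hy1 i
      · exact congrFun h0 i
    have : P *ᵥ y = z := by rw [hy, Matrix.mulVec_mulVec, h.mul_inv, Matrix.one_mulVec]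
    rw [← this, hy0, Matrix.mulVec_zero]
  · have := re_pos_of_mem_spectrum_conjTranspose h.re_pos (-μ)
      (mem_spectrum_iff_exists_mulVec.2 ⟨v, hv0, hJv⟩)
    rw [Complex.neg_re] at this
    linarith

/-- The transition matrix intertwines the two block diagonal forms of `A`, so its off-diagonal
blocks solve Sylvester equations with disjoint spectra. -/
theorem IsSplitting.transition {nu ns nu' ns' : ℕ} {P : Matrix (Fin n) (Fin nu ⊕ Fin ns) ℂ}
    {Q : Matrix (Fin nu ⊕ Fin ns) (Fin n) ℂ} {Ju : Matrix (Fin nu) (Fin nu) ℂ}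
    {Js : Matrix (Fin ns) (Fin ns) ℂ} {P' : Matrix (Fin n) (Fin nu' ⊕ Fin ns') ℂ}
    {Q' : Matrix (Fin nu' ⊕ Fin ns') (Fin n) ℂ} {Ju' : Matrix (Fin nu') (Fin nu') ℂ}
    {Js' : Matrix (Fin ns') (Fin ns') ℂ} (h : IsSplitting A P Q Ju Js)
    (h' : IsSplitting A P' Q' Ju' Js') :
    Q * P' = Matrix.fromBlocks (Q * P').toBlocks₁₁ 0 0 (Q * P').toBlocks₂₂ ∧
      Ju * (Q * P').toBlocks₁₁ = (Q * P').toBlocks₁₁ * Ju' := by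
  have h1 : Matrix.fromBlocks Ju 0 0 Js * (Q * P') = (Q * P') * Matrix.fromBlocks Ju' 0 0 Js' := by
    rw [← Matrix.mul_assoc, ← h.inv_mul_eq, ← h'.conj, Matrix.mul_assoc Q', ← Matrix.mul_assoc _ Q',
      Matrix.mul_assoc Q P', h'.mul_inv, Matrix.mul_one, Matrix.mul_assoc]
  set T := Q * P' with hT
  rw [← Matrix.fromBlocks_toBlocks T, Matrix.fromBlocks_multiply, Matrix.fromBlocks_multiply,
    Matrix.fromBlocks_inj] at h1
  simp only [Matrix.zero_mul, Matrix.mul_zero, add_zero, zero_add] at h1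
  obtain ⟨h11, h12, h21, -⟩ := h1
  refine ⟨?_, h11⟩
  have e12 : T.toBlocks₁₂ = 0 := eq_zero_of_mul_eq_mul h12 fun μ hμ hμ' =>
    not_le.2 (h.re_pos μ hμ) (h'.re_nonpos μ hμ')
  have e21 : T.toBlocks₂₁ = 0 := eq_zero_of_mul_eq_mul h21 fun μ hμ hμ' =>
    not_le.2 (h'.re_pos μ hμ') (h.re_nonpos μ hμ)
  conv_lhs => rw [← Matrix.fromBlocks_toBlocks T, e12, e21]

/-- With `t` the unstable block of the transition matrix, both `W` and `t W' tᴴ` solve the Lyapunov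
equation of `Ju`. They are therefore equal, and `t` cancels in the formula for `K`. -/
theorem IsRiccatiMatrix.unique {K K' : Matrix (Fin n) (Fin n) ℂ} (hK : IsRiccatiMatrix A B K)
    (hK' : IsRiccatiMatrix A B K') (hAB : UnstableControllable A B) : K = K' := by
  obtain ⟨nu, ns, P, Q, Ju, Js, h, rfl⟩ := isRiccatiMatrix_iff.1 hK
  obtain ⟨nu', ns', P', Q', Ju', Js', h', rfl⟩ := isRiccatiMatrix_iff.1 hK'
  obtain ⟨hT, hJ⟩ := h.transition h'
  obtain ⟨hT', -⟩ := h'.transition h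
  set t := (Q * P').toBlocks₁₁ with ht
  set s := (Q' * P).toBlocks₁₁ with hs
  have hTT : (Q * P') * (Q' * P) = 1 := by
    rw [Matrix.mul_assoc Q, ← Matrix.mul_assoc P', h'.mul_inv, Matrix.one_mul, h.inv_mul]
  have hTT' : (Q' * P) * (Q * P') = 1 := by
    rw [Matrix.mul_assoc Q', ← Matrix.mul_assoc P, h.mul_inv, Matrix.one_mul, h'.inv_mul]
  rw [hT, hT', Matrix.fromBlocks_multiply, ← Matrix.fromBlocks_one, Matrix.fromBlocks_inj] at hTT
  rw [hT, hT', Matrix.fromBlocks_multiply, ← Matrix.fromBlocks_one, Matrix.fromBlocks_inj] at hTT'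
  -- The sizes `nu` and `nu'` are not known to agree, so `t` is handled as a rectangular matrix with
  -- two-sided inverse `s`.
  have hts : t * s = 1 := by simpa using hTT.1
  have hst : s * t = 1 := by simpa using hTT'.1
  have hQ : Q = (Q * P') * Q' := by rw [Matrix.mul_assoc, h'.mul_inv, Matrix.mul_one]
  have hC : (Q * B).toRows₁ = t * (Q' * B).toRows₁ := by
    have : Q * B = (Q * P') * (Q' * B) := by rw [← Matrix.mul_assoc, ← hQ]
    rw [this, hT, ← Matrix.fromRows_toRows (Q' * B), Matrix.fromBlocks_mul_fromRows]
    simp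
  set C := (Q * B).toRows₁
  set C' := (Q' * B).toRows₁
  have hW : gramian Ju C = t * gramian Ju' C' * tᴴ := by
    apply lyapunov_unique h.re_pos
    have hJH : tᴴ * Juᴴ = Ju'ᴴ * tᴴ := by
      rw [← Matrix.conjTranspose_mul, hJ, Matrix.conjTranspose_mul]
    rw [gramian_lyapunov _ h.re_pos, hC, Matrix.conjTranspose_mul, Matrix.mul_assoc (t * _) tᴴ, hJH,
      ← Matrix.mul_assoc Ju, ← Matrix.mul_assoc Ju, hJ]
    have := congrArg (fun M => t * M * tᴴ) (gramian_lyapunov C' h'.re_pos)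
    simp only [Matrix.mul_add, Matrix.add_mul, Matrix.mul_assoc] at this ⊢
    exact this.symm
  have hu' := h'.gramian_isUnit hAB
  set W := gramian Ju C
  set W' := gramian Ju' C'
  have hW1 : W'⁻¹ * W' = 1 := Matrix.nonsing_inv_mul _ ((Matrix.isUnit_iff_isUnit_det _).1 hu')
  have hstH : sᴴ * tᴴ = 1 := by rw [← Matrix.conjTranspose_mul, hts, Matrix.conjTranspose_one]
  have htsH : tᴴ * sᴴ = 1 := by rw [← Matrix.conjTranspose_mul, hst, Matrix.conjTranspose_one]
  have hWinv : W⁻¹ = sᴴ * W'⁻¹ * s := by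
    apply Matrix.inv_eq_left_inv
    calc sᴴ * W'⁻¹ * s * W = sᴴ * (W'⁻¹ * ((s * t) * W')) * tᴴ := by
          rw [hW]; simp only [Matrix.mul_assoc]
      _ = 1 := by rw [hst, Matrix.one_mul, hW1, Matrix.mul_one, hstH]
  have hW'inv : tᴴ * W⁻¹ * t = W'⁻¹ := by
    calc tᴴ * W⁻¹ * t = (tᴴ * sᴴ) * W'⁻¹ * (s * t) := by
          rw [hWinv]; simp only [Matrix.mul_assoc]
      _ = W'⁻¹ := by rw [htsH, hst, Matrix.one_mul, Matrix.mul_one]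
  have hΛ : (Q * P')ᴴ * (Matrix.fromBlocks W⁻¹ 0 0 0 :
      Matrix (Fin nu ⊕ Fin ns) (Fin nu ⊕ Fin ns) ℂ) * (Q * P') = Matrix.fromBlocks W'⁻¹ 0 0 0 := by
    rw [hT]
    simp [Matrix.fromBlocks_conjTranspose, Matrix.fromBlocks_multiply, hW'inv]
  rw [← hΛ]
  conv_lhs => rw [hQ]
  rw [Matrix.conjTranspose_mul (Q * P')]
  simp only [Matrix.mul_assoc]

end Riccati

/-! ### Complex conjugation and the reality of the Riccati matrix. -/

section Conj

variable {ι κ ν : Type*}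

/-- The entrywise complex conjugate. -/
def entryConj (M : Matrix ι κ ℂ) : Matrix ι κ ℂ := M.map (starRingEnd ℂ)

theorem entryConj_mul [Fintype κ] (M : Matrix ι κ ℂ) (N : Matrix κ ν ℂ) :
    entryConj (M * N) = entryConj M * entryConj N := Matrix.map_mul

theorem entryConj_one [DecidableEq ι] : entryConj (1 : Matrix ι ι ℂ) = 1 := by
  simp [entryConj]

theorem entryConj_conjTranspose (M : Matrix ι κ ℂ) : entryConj Mᴴ = (entryConj M)ᴴ := by
  ext; simp [entryConj]

theorem entryConj_toComplex (M : Matrix ι κ ℝ) : entryConj (toComplex M) = toComplex M := by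
  ext; simp [entryConj, toComplex]

theorem entryConj_inv [Fintype ι] [DecidableEq ι] {W : Matrix ι ι ℂ} (h : IsUnit W) :
    (entryConj W)⁻¹ = entryConj W⁻¹ := by
  apply Matrix.inv_eq_left_inv
  rw [← entryConj_mul, Matrix.nonsing_inv_mul _ ((Matrix.isUnit_iff_isUnit_det _).1 h),
    entryConj_one]

theorem star_mem_spectrum_of_entryConj [Fintype ι] [DecidableEq ι] {J : Matrix ι ι ℂ} {μ : ℂ}
    (h : μ ∈ spectrum ℂ (entryConj J)) : star μ ∈ spectrum ℂ J := by
  obtain ⟨x, hx0, hx⟩ := mem_spectrum_iff_exists_mulVec.1 h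
  refine mem_spectrum_iff_exists_mulVec.2 ⟨star x, by simpa using hx0, ?_⟩
  ext i
  have := congrArg star (congrFun hx i)
  simpa [Matrix.mulVec, dotProduct, entryConj] using this

theorem IsSplitting.entryConj {n nu ns : ℕ} {A : Matrix (Fin n) (Fin n) ℝ}
    {P : Matrix (Fin n) (Fin nu ⊕ Fin ns) ℂ} {Q : Matrix (Fin nu ⊕ Fin ns) (Fin n) ℂ}
    {Ju : Matrix (Fin nu) (Fin nu) ℂ} {Js : Matrix (Fin ns) (Fin ns) ℂ}
    (h : IsSplitting (toComplex A) P Q Ju Js) :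
    IsSplitting (toComplex A) (entryConj P) (entryConj Q) (entryConj Ju) (entryConj Js) where
  mul_inv := by rw [← entryConj_mul, h.mul_inv, entryConj_one]
  inv_mul := by rw [← entryConj_mul, h.inv_mul, entryConj_one]
  conj := by
    rw [← entryConj_toComplex, ← entryConj_mul, ← entryConj_mul, h.conj]
    simp [MinEnergy.entryConj, Matrix.fromBlocks_map]
  re_pos := fun μ hμ => by simpa using h.re_pos _ (star_mem_spectrum_of_entryConj hμ)
  re_nonpos := fun μ hμ => by simpa using h.re_nonpos _ (star_mem_spectrum_of_entryConj hμ)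

/-- Conjugating the Lyapunov equation avoids conjugating the exponentials under the integral. -/
theorem entryConj_gramian {k m : ℕ} {J : Matrix (Fin k) (Fin k) ℂ} (C : Matrix (Fin k) (Fin m) ℂ)
    (hJ : ∀ μ ∈ spectrum ℂ J, 0 < μ.re) :
    gramian (entryConj J) (entryConj C) = entryConj (gramian J C) := by
  have hJ' : ∀ μ ∈ spectrum ℂ (entryConj J), 0 < μ.re := fun μ hμ => by
    simpa using hJ _ (star_mem_spectrum_of_entryConj hμ)
  apply lyapunov_unique hJ'
  rw [gramian_lyapunov _ hJ']
  have := congrArg entryConj (gramian_lyapunov C hJ)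
  rw [show entryConj (J * gramian J C + gramian J C * Jᴴ) = entryConj (J * gramian J C)
    + entryConj (gramian J C * Jᴴ) from Matrix.map_add _ (map_add _) _ _] at this
  simpa only [entryConj_mul, entryConj_conjTranspose] using this.symm

theorem IsRiccatiMatrix.entryConj {n m : ℕ} {A : Matrix (Fin n) (Fin n) ℝ}
    {B : Matrix (Fin n) (Fin m) ℝ} {K : Matrix (Fin n) (Fin n) ℂ}
    (hK : IsRiccatiMatrix (toComplex A) (toComplex B) K)
    (hAB : UnstableControllable (toComplex A) (toComplex B)) :
    IsRiccatiMatrix (toComplex A) (toComplex B) (entryConj K) := by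
  obtain ⟨nu, ns, P, Q, Ju, Js, h, rfl⟩ := isRiccatiMatrix_iff.1 hK
  refine isRiccatiMatrix_iff.2 ⟨nu, ns, _, _, _, _, h.entryConj, ?_⟩
  have h1 : (MinEnergy.entryConj Q * toComplex B).toRows₁
      = MinEnergy.entryConj (Q * toComplex B).toRows₁ := by
    rw [← entryConj_toComplex B, ← entryConj_mul, entryConj_toComplex]; rfl
  rw [h1, entryConj_gramian _ h.re_pos, entryConj_inv (h.gramian_isUnit hAB), entryConj_mul,
    entryConj_mul, entryConj_conjTranspose]
  congr 2
  simp [MinEnergy.entryConj, Matrix.fromBlocks_map]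

/-- For real data the conjugate of a splitting is again a splitting, so the conjugate of `K` is also
a Riccati matrix, and uniqueness makes it equal to `K`. -/
theorem exists_real_isRiccatiMatrix {n m : ℕ} {A : Matrix (Fin n) (Fin n) ℝ}
    {B : Matrix (Fin n) (Fin m) ℝ} (hAB : UnstableControllable (toComplex A) (toComplex B)) :
    ∃ K : Matrix (Fin n) (Fin n) ℝ, IsRiccatiMatrix (toComplex A) (toComplex B) (toComplex K) := by
  obtain ⟨K, hK⟩ := exists_isRiccatiMatrix (toComplex A) (toComplex B)
  have h := (hK.entryConj hAB).unique hK hAB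
  refine ⟨K.map Complex.re, ?_⟩
  convert hK using 1
  ext i j
  exact Complex.conj_eq_iff_re.1 (congrFun (congrFun h i) j)

end Conj

/-! ### Real matrices and their complexifications -/

section ToComplex

variable {ι κ ν : Type*}

theorem toComplex_mul [Fintype κ] (M : Matrix ι κ ℝ) (N : Matrix κ ν ℝ) :
    toComplex (M * N) = toComplex M * toComplex N :=
  Matrix.map_mul (f := Complex.ofRealHom)

theorem toComplex_add (M N : Matrix ι κ ℝ) : toComplex (M + N) = toComplex M + toComplex N := by
  ext; simp [toComplex]

theorem toComplex_sub (M N : Matrix ι κ ℝ) : toComplex (M - N) = toComplex M - toComplex N := by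
  ext; simp [toComplex]

theorem toComplex_neg (M : Matrix ι κ ℝ) : toComplex (-M) = -toComplex M := by
  ext; simp [toComplex]

theorem conjTranspose_toComplex (M : Matrix ι κ ℝ) : (toComplex M)ᴴ = toComplex Mᵀ := by
  ext; simp [toComplex]

theorem toComplex_injective : Function.Injective (toComplex : Matrix ι κ ℝ → Matrix ι κ ℂ) := by
  intro M N h
  ext i j
  simpa [toComplex] using congrFun (congrFun h i) j

/-- The complex vector with the same (real) entries. -/
def vecToComplex (x : ι → ℝ) : ι → ℂ := fun i => (x i : ℂ)

theorem toComplex_mulVec [Fintype κ] (M : Matrix ι κ ℝ) (x : κ → ℝ) :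
    toComplex M *ᵥ vecToComplex x = vecToComplex (M *ᵥ x) := by
  ext; simp [toComplex, vecToComplex, Matrix.mulVec, dotProduct]

theorem norm_vecToComplex [Fintype ι] (x : ι → ℝ) : ‖vecToComplex x‖ = ‖x‖ := by
  simp [Pi.norm_def, vecToComplex, nnnorm]

variable [Fintype ι] [DecidableEq ι]

theorem toComplex_exp (N : Matrix ι ι ℝ) :
    toComplex (NormedSpace.exp N) = NormedSpace.exp (toComplex N) := by
  let _ : NormedRing (Matrix ι ι ℝ) := Matrix.linftyOpNormedRing
  let _ : NormedAlgebra ℝ (Matrix ι ι ℝ) := Matrix.linftyOpNormedAlgebra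
  let _ : NormedAlgebra ℚ (Matrix ι ι ℝ) := NormedAlgebra.restrictScalars ℚ ℝ _
  let _ : NormedRing (Matrix ι ι ℂ) := Matrix.linftyOpNormedRing
  let _ : NormedAlgebra ℝ (Matrix ι ι ℂ) := Matrix.linftyOpNormedAlgebra
  let _ : NormedAlgebra ℚ (Matrix ι ι ℂ) := NormedAlgebra.restrictScalars ℚ ℝ _
  exact NormedSpace.map_exp (Complex.ofRealHom.mapMatrix : Matrix ι ι ℝ →+* Matrix ι ι ℂ)
    (show Continuous fun M : Matrix ι ι ℝ => M.map Complex.ofReal from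
      continuous_id.matrix_map Complex.continuous_ofReal) N

theorem flow_toComplex (N : Matrix ι ι ℝ) (x : ι → ℝ) (t : ℝ) :
    flow (toComplex N) (vecToComplex x) t = vecToComplex (flow N x t) := by
  have : t • toComplex N = toComplex (t • N) := by ext; simp [toComplex]
  rw [flow, flow, this, ← toComplex_exp, toComplex_mulVec]

theorem expDecay_flow_toComplex {N : Matrix ι ι ℝ} {x : ι → ℝ} :
    ExpDecay (flow (toComplex N) (vecToComplex x)) ↔ ExpDecay (flow N x) := by
  simp only [ExpDecay, flow_toComplex, norm_vecToComplex]

theorem tendsto_flow_toComplex {N : Matrix ι ι ℝ} {x : ι → ℝ} :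
    Tendsto (flow (toComplex N) (vecToComplex x)) atTop (𝓝 0) ↔
      Tendsto (flow N x) atTop (𝓝 0) := by
  rw [tendsto_zero_iff_norm_tendsto_zero, tendsto_zero_iff_norm_tendsto_zero (f := flow N x)]
  simp only [flow_toComplex, norm_vecToComplex]

theorem star_mem_spectrum_conjTranspose {J : Matrix ι ι ℂ} {μ : ℂ} (h : μ ∈ spectrum ℂ Jᴴ) :
    star μ ∈ spectrum ℂ J := by
  rwa [← Matrix.star_eq_conjTranspose, spectrum.map_star] at h

end ToComplex

/-! ### The real Riccati equation and the real stable space. -/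

section Real

variable {n m : ℕ}

/-- A left eigenvector of `A` orthogonal to `B` is a left eigenvector of every `A + B F` for the
same eigenvalue: feedback cannot move it. -/
theorem IsStabilizable.unstableControllable {A : Matrix (Fin n) (Fin n) ℝ}
    {B : Matrix (Fin n) (Fin m) ℝ} (h : IsStabilizable A B) :
    UnstableControllable (toComplex A) (toComplex B) := by
  obtain ⟨F, hF⟩ := h
  intro z μ hz hBz hμ
  by_contra hz0
  have h1 : (toComplex (A + B * F))ᴴ *ᵥ z = μ • z := by
    rw [toComplex_add, toComplex_mul, Matrix.conjTranspose_add, Matrix.conjTranspose_mul,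
      Matrix.add_mulVec, ← Matrix.mulVec_mulVec, hBz, hz]
    simp
  have := hF _ (star_mem_spectrum_conjTranspose (mem_spectrum_iff_exists_mulVec.2 ⟨z, hz0, h1⟩))
  simp only [RCLike.star_def, Complex.conj_re] at this
  linarith

/-- The real properties of the Riccati matrix that the control problem needs. -/
structure IsRiccatiSolution (A : Matrix (Fin n) (Fin n) ℝ) (B : Matrix (Fin n) (Fin m) ℝ)
    (K : Matrix (Fin n) (Fin n) ℝ) : Prop where
  symm : Kᵀ = K
  riccati : Aᵀ * K + K * A = K * B * Bᵀ * K
  spectrum_re_nonpos : ∀ μ ∈ spectrum ℂ (toComplex (A - B * Bᵀ * K)), μ.re ≤ 0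

theorem IsRiccatiMatrix.isRiccatiSolution {A : Matrix (Fin n) (Fin n) ℝ}
    {B : Matrix (Fin n) (Fin m) ℝ} {K : Matrix (Fin n) (Fin n) ℝ}
    (hAB : UnstableControllable (toComplex A) (toComplex B))
    (hK : IsRiccatiMatrix (toComplex A) (toComplex B) (toComplex K)) :
    IsRiccatiSolution A B K where
  symm := toComplex_injective (by rw [← conjTranspose_toComplex, hK.isHermitian])
  riccati := toComplex_injective (by
    simpa only [toComplex_add, toComplex_mul, conjTranspose_toComplex] using hK.riccati hAB)
  spectrum_re_nonpos := by
    simpa only [toComplex_sub, toComplex_mul, conjTranspose_toComplex] using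
      hK.spectrum_closedLoop hAB

/-- Negating and transposing the closed loop puts the spectrum into the closed right half-plane.
This is the rigidity that identifies the adjoint state with `K x`. -/
theorem IsRiccatiSolution.eq_zero_of_tendsto {A : Matrix (Fin n) (Fin n) ℝ}
    {B : Matrix (Fin n) (Fin m) ℝ} {K : Matrix (Fin n) (Fin n) ℝ} (hK : IsRiccatiSolution A B K)
    {q : Fin n → ℝ} (hq : Tendsto (flow (-(A - B * Bᵀ * K)ᵀ) q) atTop (𝓝 0)) : q = 0 := by
  have h1 : vecToComplex q = 0 := by
    refine eq_zero_of_tendsto_flow (fun μ hμ => ?_) (tendsto_flow_toComplex.2 hq)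
    rw [toComplex_neg, ← spectrum.neg_eq, ← conjTranspose_toComplex] at hμ
    have := hK.spectrum_re_nonpos _ (star_mem_spectrum_conjTranspose hμ)
    simpa using this
  ext i
  simpa [vecToComplex] using congrFun h1 i

/-- The real initial values from which the flow of `N` tends to zero. -/
def realStable (N : Matrix (Fin n) (Fin n) ℝ) : Submodule ℝ (Fin n → ℝ) where
  carrier := {x | Tendsto (flow N x) atTop (𝓝 0)}
  zero_mem' := by
    have : flow N (0 : Fin n → ℝ) = fun _ => 0 := by funext t; simp [flow]
    simp [this]
  add_mem' := fun {x y} hx hy => by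
    have : flow N (x + y) = fun t => flow N x t + flow N y t := funext (flow_add N x y)
    simpa [this] using Tendsto.add hx hy
  smul_mem' := fun c x hx => by
    have : flow N (c • x) = fun t => c • flow N x t := funext (flow_smul N c x)
    simpa [this] using Tendsto.const_smul hx c

theorem mem_realStable {N : Matrix (Fin n) (Fin n) ℝ} {x : Fin n → ℝ} :
    x ∈ realStable N ↔ Tendsto (flow N x) atTop (𝓝 0) := Iff.rfl

theorem vecToComplex_mem_stableSubspace {N : Matrix (Fin n) (Fin n) ℝ} {x : Fin n → ℝ} :
    vecToComplex x ∈ stableSubspace (toComplex N) ↔ x ∈ realStable N := by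
  rw [← flowStable_eq_stableSubspace, mem_flowStable, tendsto_flow_toComplex, mem_realStable]

theorem flow_re_im (N : Matrix (Fin n) (Fin n) ℝ) (z : Fin n → ℂ) (t : ℝ) (i : Fin n) :
    flow N (fun j => (z j).re) t i = (flow (toComplex N) z t i).re ∧
      flow N (fun j => (z j).im) t i = (flow (toComplex N) z t i).im := by
  have hz : z = vecToComplex (fun j => (z j).re) + Complex.I • vecToComplex (fun j => (z j).im) := by
    ext j
    simp [vecToComplex, mul_comm Complex.I, Complex.re_add_im]
  have h : flow (toComplex N) z t = vecToComplex (flow N (fun j => (z j).re) t)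
      + Complex.I • vecToComplex (flow N (fun j => (z j).im) t) := by
    conv_lhs => rw [hz]
    rw [flow_add, flow_smul, flow_toComplex, flow_toComplex]
  rw [h]
  simp [vecToComplex]

theorem re_im_mem_realStable {N : Matrix (Fin n) (Fin n) ℝ} {z : Fin n → ℂ}
    (hz : z ∈ stableSubspace (toComplex N)) :
    (fun j => (z j).re) ∈ realStable N ∧ (fun j => (z j).im) ∈ realStable N := by
  rw [← flowStable_eq_stableSubspace, mem_flowStable, tendsto_pi_nhds] at hz
  constructor <;> rw [mem_realStable, tendsto_pi_nhds] <;> intro i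
  · simp only [(flow_re_im N z _ i).1]
    exact (Complex.continuous_re.tendsto 0).comp (hz i)
  · simp only [(flow_re_im N z _ i).2]
    exact (Complex.continuous_im.tendsto 0).comp (hz i)

theorem linearIndependent_vecToComplex {k : ℕ} {b : Fin k → Fin n → ℝ}
    (hb : LinearIndependent ℝ b) : LinearIndependent ℂ (fun i => vecToComplex (b i)) := by
  rw [Fintype.linearIndependent_iff] at *
  intro g hg i
  have hre := hb (fun i => (g i).re) (by
    ext j
    simpa [vecToComplex] using congrArg Complex.re (congrFun hg j)) i
  have him := hb (fun i => (g i).im) (by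
    ext j
    simpa [vecToComplex] using congrArg Complex.im (congrFun hg j)) i
  exact Complex.ext hre him

/-- Uniqueness: a real vector that is a complex combination of real vectors is also the combination
with the real parts of the coefficients. Existence: real and imaginary parts of a stable vector are
stable, so a real basis of `realStable N` spans the complex space. -/
theorem isRealSpanOfRealBasis_stableSubspace_iff (N : Matrix (Fin n) (Fin n) ℝ)
    (R : Submodule ℝ (Fin n → ℝ)) :
    IsRealSpanOfRealBasis (stableSubspace (toComplex N)) R ↔ R = realStable N := by
  constructor
  · rintro ⟨k, b, -, hspan, rfl⟩
    apply le_antisymm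
    · refine Submodule.span_le.2 ?_
      rintro _ ⟨i, rfl⟩
      refine vecToComplex_mem_stableSubspace.1 ?_
      rw [← hspan]
      exact Submodule.subset_span ⟨i, rfl⟩
    · intro x hx
      have h := vecToComplex_mem_stableSubspace.2 hx
      rw [← hspan, Submodule.mem_span_range_iff_exists_fun] at h
      obtain ⟨c, hc⟩ := h
      refine (Submodule.mem_span_range_iff_exists_fun ℝ).2 ⟨fun i => (c i).re, ?_⟩
      ext j
      simpa [vecToComplex] using congrArg Complex.re (congrFun hc j)
  · rintro rfl
    let b := Module.finBasis ℝ (realStable N)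
    refine ⟨_, fun i => (b i : Fin n → ℝ), ?_, ?_, ?_⟩
    · exact linearIndependent_vecToComplex
        (b.linearIndependent.map' (realStable N).subtype (Submodule.ker_subtype _))
    · apply le_antisymm
      · refine Submodule.span_le.2 ?_
        rintro _ ⟨i, rfl⟩
        exact vecToComplex_mem_stableSubspace.2 (b i).2
      · intro z hz
        obtain ⟨h1, h2⟩ := re_im_mem_realStable hz
        have key : ∀ x ∈ realStable N, vecToComplex x ∈ Submodule.span ℂ
            (Set.range fun i => fun j => ((b i : Fin n → ℝ) j : ℂ)) := by
          intro x hx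
          refine (Submodule.mem_span_range_iff_exists_fun ℂ).2 ⟨fun i => (b.repr ⟨x, hx⟩ i : ℂ), ?_⟩
          have h3 := congrArg Subtype.val (b.sum_repr ⟨x, hx⟩)
          ext j
          have h4 : ∑ i, b.repr ⟨x, hx⟩ i * (b i : Fin n → ℝ) j = x j := by
            have h5 := congrFun h3 j
            rw [Submodule.coe_sum, Finset.sum_apply] at h5
            exact h5
          simp only [vecToComplex, ← h4]
          simp
        have hz : z = vecToComplex (fun j => (z j).re)
            + Complex.I • vecToComplex (fun j => (z j).im) := by
          ext j
          simp [vecToComplex, mul_comm Complex.I, Complex.re_add_im]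
        rw [hz]
        exact Submodule.add_mem _ (key _ h1) (Submodule.smul_mem _ _ (key _ h2))
    · have h1 : Set.range (fun i => (b i : Fin n → ℝ))
          = (realStable N).subtype '' Set.range b := by
        rw [← Set.range_comp]; rfl
      rw [h1, Submodule.span_image, b.span_eq, Submodule.map_subtype_top]

theorem expDecay_flow_of_mem_realStable {N : Matrix (Fin n) (Fin n) ℝ} {x : Fin n → ℝ}
    (hx : x ∈ realStable N) : ExpDecay (flow N x) :=
  expDecay_flow_toComplex.1 (expDecay_flow_of_tendsto (tendsto_flow_toComplex.2 hx))

theorem IsHurwitz.expDecay_flow {N : Matrix (Fin n) (Fin n) ℝ} (hN : IsHurwitz N)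
    (x : Fin n → ℝ) : ExpDecay (flow N x) :=
  expDecay_flow_toComplex.1 (expDecay_flow_of_spectrum hN _)

theorem IsHurwitz.transpose {N : Matrix (Fin n) (Fin n) ℝ} (hN : IsHurwitz N) :
    IsHurwitz Nᵀ := by
  intro μ hμ
  rw [← conjTranspose_toComplex] at hμ
  simpa using hN _ (star_mem_spectrum_conjTranspose hμ)

end Real

/-! ### Calculus of primitives of locally integrable functions -/

section Primitive

/-- `x` is a primitive on `[0, ∞)` of the locally integrable function `f`. -/
def IsPrimitive (x f : ℝ → ℝ) : Prop :=
  (∀ T : ℝ, 0 ≤ T → IntervalIntegrable f volume 0 T) ∧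
    ∀ t : ℝ, 0 ≤ t → x t = x 0 + ∫ s in (0 : ℝ)..t, f s

theorem IsPrimitive.of_hasDerivAt {x f : ℝ → ℝ} (hf : Continuous f)
    (h : ∀ t, HasDerivAt x (f t) t) : IsPrimitive x f := by
  refine ⟨fun T _ => hf.intervalIntegrable _ _, fun t _ => ?_⟩
  rw [intervalIntegral.integral_eq_sub_of_hasDerivAt (fun s _ => h s) (hf.intervalIntegrable _ _)]
  ring

theorem IsPrimitive.integral {f : ℝ → ℝ} (c : ℝ)
    (hf : ∀ T : ℝ, 0 ≤ T → IntervalIntegrable f volume 0 T) :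
    IsPrimitive (fun t => c + ∫ s in (0 : ℝ)..t, f s) f :=
  ⟨hf, fun t _ => by simp⟩

theorem IsPrimitive.absolutelyContinuous {f : ℝ → ℝ} (c : ℝ) {T : ℝ}
    (hf : IntervalIntegrable f volume 0 T) :
    AbsolutelyContinuousOnInterval (fun t => c + ∫ s in (0 : ℝ)..t, f s) 0 T := by
  have h1 : AbsolutelyContinuousOnInterval (fun _ : ℝ => c) 0 T :=
    (LipschitzWith.const c).lipschitzOnWith.absolutelyContinuousOnInterval
  exact h1.add (hf.absolutelyContinuousOnInterval_intervalIntegral Set.left_mem_uIcc)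

theorem IsPrimitive.continuousOn_Icc {x f : ℝ → ℝ} (h : IsPrimitive x f) {T : ℝ} (hT : 0 ≤ T) :
    ContinuousOn x (Set.Icc 0 T) := by
  have h1 := (IsPrimitive.absolutelyContinuous (x 0) (h.1 T hT)).continuousOn
  rw [Set.uIcc_of_le hT] at h1
  exact h1.congr fun t ht => h.2 t ht.1

theorem IsPrimitive.continuousOn {x f : ℝ → ℝ} (h : IsPrimitive x f) :
    ContinuousOn x (Set.Ici 0) := by
  intro t ht
  have h1 := h.continuousOn_Icc (T := t + 1) (by have := Set.mem_Ici.1 ht; linarith) t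
    ⟨ht, by linarith⟩
  refine h1.mono_of_mem_nhdsWithin ?_
  rw [← Set.Ici_inter_Iic]
  exact inter_mem_nhdsWithin _ (Iic_mem_nhds (by linarith))

/-- Integration by parts for absolutely continuous functions. Controls are only square integrable,
so trajectories need not be differentiable everywhere. -/
theorem IsPrimitive.mul {x f y g : ℝ → ℝ} (hx : IsPrimitive x f) (hy : IsPrimitive y g) :
    IsPrimitive (fun t => x t * y t) (fun t => f t * y t + x t * g t) := by
  refine ⟨fun T hT => ?_, fun T hT => ?_⟩
  · have hxc := hx.continuousOn_Icc hT
    have hyc := hy.continuousOn_Icc hT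
    rw [← Set.uIcc_of_le hT] at hxc hyc
    exact ((hx.1 T hT).mul_continuousOn hyc).add ((hy.1 T hT).continuousOn_mul hxc)
  -- The function `x` is known only for nonnegative times, so the formula `x 0 + ∫ f` replaces it;
  -- by Lebesgue differentiation its derivative is `f` almost everywhere on the interval.
  · have hX := IsPrimitive.absolutelyContinuous (x 0) (hx.1 T hT)
    have hY := IsPrimitive.absolutelyContinuous (y 0) (hy.1 T hT)
    have h := hX.integral_deriv_mul_eq_sub hY
    simp only [← hx.2 T hT, ← hy.2 T hT, intervalIntegral.integral_same, add_zero] at h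
    beta_reduce
    rw [eq_comm, ← eq_sub_iff_add_eq', ← h]
    apply intervalIntegral.integral_congr_ae
    filter_upwards [(hx.1 T hT).ae_hasDerivAt_integral, (hy.1 T hT).ae_hasDerivAt_integral]
      with t h1 h2 ht
    have ht' : t ∈ Set.uIcc 0 T := Set.uIoc_subset_uIcc ht
    have ht0 : 0 ≤ t := by rw [Set.uIoc_of_le hT] at ht; exact ht.1.le
    rw [((h1 ht' 0 Set.left_mem_uIcc).const_add (x 0)).deriv,
      ((h2 ht' 0 Set.left_mem_uIcc).const_add (y 0)).deriv, ← hx.2 t ht0, ← hy.2 t ht0]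

theorem IsPrimitive.add {x f y g : ℝ → ℝ} (hx : IsPrimitive x f) (hy : IsPrimitive y g) :
    IsPrimitive (fun t => x t + y t) (fun t => f t + g t) := by
  refine ⟨fun T hT => (hx.1 T hT).add (hy.1 T hT), fun T hT => ?_⟩
  beta_reduce
  rw [intervalIntegral.integral_add (hx.1 T hT) (hy.1 T hT), hx.2 T hT, hy.2 T hT]
  ring

theorem IsPrimitive.const_mul {x f : ℝ → ℝ} (hx : IsPrimitive x f) (c : ℝ) :
    IsPrimitive (fun t => c * x t) (fun t => c * f t) := by
  refine ⟨fun T hT => (hx.1 T hT).const_mul c, fun T hT => ?_⟩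
  beta_reduce
  rw [intervalIntegral.integral_const_mul, hx.2 T hT]
  ring

theorem IsPrimitive.sub {x f y g : ℝ → ℝ} (hx : IsPrimitive x f) (hy : IsPrimitive y g) :
    IsPrimitive (fun t => x t - y t) (fun t => f t - g t) := by
  simpa [sub_eq_add_neg] using hx.add (hy.const_mul (-1))

theorem IsPrimitive.sum {κ : Type*} (s : Finset κ) {x f : κ → ℝ → ℝ}
    (h : ∀ i ∈ s, IsPrimitive (x i) (f i)) :
    IsPrimitive (fun t => ∑ i ∈ s, x i t) (fun t => ∑ i ∈ s, f i t) := by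
  classical
  induction s using Finset.induction_on with
  | empty => exact ⟨by simp, by simp⟩
  | insert a s ha ih =>
    simp_rw [Finset.sum_insert ha]
    exact (h a (Finset.mem_insert_self a s)).add
      (ih fun i hi => h i (Finset.mem_insert_of_mem hi))

theorem integral_congr_ae_Ici {f g : ℝ → ℝ} (hfg : f =ᵐ[volume.restrict (Set.Ici 0)] g)
    {T : ℝ} (hT : 0 ≤ T) : f =ᵐ[volume.restrict (Set.uIoc 0 T)] g := by
  refine ae_restrict_of_ae_restrict_of_subset (fun t ht => ?_) hfg
  rw [Set.uIoc_of_le hT] at ht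
  exact ht.1.le

theorem IsPrimitive.congr_ae {x f g : ℝ → ℝ} (hx : IsPrimitive x f)
    (hfg : f =ᵐ[volume.restrict (Set.Ici 0)] g) : IsPrimitive x g := by
  refine ⟨fun T hT => (hx.1 T hT).congr_ae (integral_congr_ae_Ici hfg hT), fun T hT => ?_⟩
  rw [hx.2 T hT]
  congr 1
  exact intervalIntegral.integral_congr_ae_restrict (integral_congr_ae_Ici hfg hT)

variable {ι κ : Type*}

/-- `x` is a primitive on `[0, ∞)` of the locally integrable vector function `f`. -/
def IsVecPrimitive (x f : ℝ → ι → ℝ) : Prop :=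
  ∀ i, IsPrimitive (fun t => x t i) (fun t => f t i)

theorem IsVecPrimitive.dotProduct [Fintype ι] {x f y g : ℝ → ι → ℝ} (hx : IsVecPrimitive x f)
    (hy : IsVecPrimitive y g) :
    IsPrimitive (fun t => x t ⬝ᵥ y t) (fun t => f t ⬝ᵥ y t + x t ⬝ᵥ g t) := by
  have := IsPrimitive.sum Finset.univ fun i _ => (hx i).mul (hy i)
  simpa only [_root_.dotProduct, ← Finset.sum_add_distrib] using this

theorem IsVecPrimitive.mulVec [Fintype ι] {x f : ℝ → ι → ℝ} (hx : IsVecPrimitive x f) (M : Matrix κ ι ℝ) :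
    IsVecPrimitive (fun t => M *ᵥ x t) (fun t => M *ᵥ f t) := fun i =>
  IsPrimitive.sum Finset.univ fun j _ => (hx j).const_mul (M i j)

theorem IsVecPrimitive.sub {x f y g : ℝ → ι → ℝ} (hx : IsVecPrimitive x f)
    (hy : IsVecPrimitive y g) : IsVecPrimitive (fun t => x t - y t) (fun t => f t - g t) :=
  fun i => (hx i).sub (hy i)

theorem IsVecPrimitive.add {x f y g : ℝ → ι → ℝ} (hx : IsVecPrimitive x f)
    (hy : IsVecPrimitive y g) : IsVecPrimitive (fun t => x t + y t) (fun t => f t + g t) :=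
  fun i => (hx i).add (hy i)

theorem IsVecPrimitive.congr_ae {x f g : ℝ → ι → ℝ} (hx : IsVecPrimitive x f)
    (hfg : f =ᵐ[volume.restrict (Set.Ici 0)] g) : IsVecPrimitive x g := fun i =>
  (hx i).congr_ae (hfg.mono fun _ ht => congrFun ht i)

theorem IsVecPrimitive.continuousOn {x f : ℝ → ι → ℝ} (hx : IsVecPrimitive x f) :
    ContinuousOn x (Set.Ici 0) := continuousOn_pi.2 fun i => (hx i).continuousOn

variable [Fintype ι] [DecidableEq ι]

theorem isVecPrimitive_flow (N : Matrix ι ι ℝ) (x : ι → ℝ) :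
    IsVecPrimitive (flow N x) (fun t => N *ᵥ flow N x t) := fun i =>
  IsPrimitive.of_hasDerivAt
    ((continuous_apply i).comp (continuous_const.matrix_mulVec (continuous_flow N x)))
    fun t => hasDerivAt_pi.1 (hasDerivAt_flow N x t) i

theorem exp_smul_transpose_dotProduct (N : Matrix ι ι ℝ) (x y : ι → ℝ) (t : ℝ) :
    flow Nᵀ x t ⬝ᵥ y = x ⬝ᵥ flow N y t := by
  rw [flow, flow, ← Matrix.transpose_smul, Matrix.exp_transpose, Matrix.mulVec_transpose,
    Matrix.dotProduct_mulVec]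

/-- Solutions of a linear differential equation are unique. -/
theorem IsVecPrimitive.eq_flow {N : Matrix ι ι ℝ} {y : ℝ → ι → ℝ}
    (hy : IsVecPrimitive y (fun t => N *ᵥ y t)) {t : ℝ} (ht : 0 ≤ t) : y t = flow N (y 0) t := by
  refine dotProduct_eq _ _ fun d => ?_
  rw [dotProduct_comm (y t), dotProduct_comm (flow _ _ _)]
  -- The pairing of `y` with a solution of the adjoint equation is constant in time; this initial
  -- value makes the adjoint solution equal to `d` at time `t`.
  set c := flow Nᵀ d t with hc
  have hp := (isVecPrimitive_flow (-Nᵀ) c).dotProduct hy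
  have h0 : ∀ s, (-Nᵀ) *ᵥ flow (-Nᵀ) c s ⬝ᵥ y s + flow (-Nᵀ) c s ⬝ᵥ N *ᵥ y s = 0 := by
    intro s
    rw [Matrix.dotProduct_mulVec, ← Matrix.mulVec_transpose, Matrix.neg_mulVec, neg_dotProduct,
      neg_add_cancel]
  have h1 := hp.2 t ht
  simp only [h0, intervalIntegral.integral_zero, add_zero, flow_zero] at h1
  have h2 : flow (-Nᵀ) c t = d := by
    rw [hc, flow, flow, Matrix.mulVec_mulVec]
    have : t • (-Nᵀ) = (-t) • Nᵀ := by simp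
    rw [this, exp_neg_smul_mul_exp_smul, Matrix.one_mulVec]
  rw [h2, hc, exp_smul_transpose_dotProduct] at h1
  exact h1

theorem intervalIntegrable_exp_mulVec (N : Matrix ι ι ℝ) {g : ℝ → ι → ℝ}
    (hg : ∀ i, ∀ T : ℝ, 0 ≤ T → IntervalIntegrable (fun t => g t i) volume 0 T) (i : ι) (T : ℝ)
    (hT : 0 ≤ T) :
    IntervalIntegrable (fun s => (NormedSpace.exp ((-s) • N) *ᵥ g s) i) volume 0 T := by
  simp only [Matrix.mulVec, dotProduct]
  have hc := (continuous_exp_smul N).comp continuous_neg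
  have e : (fun s => ∑ j, NormedSpace.exp ((-s) • N) i j * g s j)
      = ∑ j, fun s => NormedSpace.exp ((-s) • N) i j * g s j := by
    funext s
    rw [Finset.sum_apply]
  rw [e]
  exact IntervalIntegrable.sum _ fun j _ =>
    (hg j T hT).continuousOn_mul (hc.matrix_elem i j).continuousOn

/-- The solution of `y' = N y + g`, `y 0 = c`, by variation of constants. -/
noncomputable def forcedFlow (N : Matrix ι ι ℝ) (c : ι → ℝ) (g : ℝ → ι → ℝ) (t : ℝ) : ι → ℝ :=
  flow N (fun i => c i + ∫ s in (0 : ℝ)..t, (NormedSpace.exp ((-s) • N) *ᵥ g s) i) t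

theorem forcedFlow_zero (N : Matrix ι ι ℝ) (c : ι → ℝ) (g : ℝ → ι → ℝ) :
    forcedFlow N c g 0 = c := by
  simp [forcedFlow, flow_zero]

theorem isVecPrimitive_forcedFlow (N : Matrix ι ι ℝ) (c : ι → ℝ) {g : ℝ → ι → ℝ}
    (hg : ∀ i, ∀ T : ℝ, 0 ≤ T → IntervalIntegrable (fun t => g t i) volume 0 T) :
    IsVecPrimitive (forcedFlow N c g) (fun t => N *ᵥ forcedFlow N c g t + g t) := by
  intro i
  have hE : ∀ j, IsPrimitive (fun t => NormedSpace.exp (t • N) i j)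
      (fun t => (N * NormedSpace.exp (t • N)) i j) := fun j =>
    IsPrimitive.of_hasDerivAt ((continuous_const.matrix_mul (continuous_exp_smul N)).matrix_elem i j)
      fun t => hasDerivAt_pi.1 (hasDerivAt_pi.1 (hasDerivAt_exp_smul N t) i) j
  have hh : ∀ j, IsPrimitive
      (fun t => c j + ∫ s in (0 : ℝ)..t, (NormedSpace.exp ((-s) • N) *ᵥ g s) j)
      (fun t => (NormedSpace.exp ((-t) • N) *ᵥ g t) j) := fun j =>
    IsPrimitive.integral (c j) (intervalIntegrable_exp_mulVec N hg j)
  have h := IsPrimitive.sum Finset.univ fun j _ => (hE j).mul (hh j)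
  simp only [Finset.sum_add_distrib] at h
  have h1 : ∀ t, N *ᵥ forcedFlow N c g t = (N * NormedSpace.exp (t • N)) *ᵥ
      fun i => c i + ∫ s in (0 : ℝ)..t, (NormedSpace.exp ((-s) • N) *ᵥ g s) i := fun t => by
    rw [forcedFlow, flow, Matrix.mulVec_mulVec]
  have h2 : ∀ t, g t = NormedSpace.exp (t • N) *ᵥ (NormedSpace.exp ((-t) • N) *ᵥ g t) := fun t => by
    rw [Matrix.mulVec_mulVec, exp_smul_mul_exp_neg_smul, Matrix.one_mulVec]
  have h3 : (fun t => (N *ᵥ forcedFlow N c g t + g t) i)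
      = fun t => (N *ᵥ forcedFlow N c g t) i
        + (NormedSpace.exp (t • N) *ᵥ (NormedSpace.exp ((-t) • N) *ᵥ g t)) i := by
    funext t
    rw [← h2, Pi.add_apply]
  rw [h3]
  simp only [h1]
  exact h

end Primitive

/-! ### Square integrable controls and their trajectories -/

section Control

variable {n m : ℕ}

/-- Every component of `u` is square integrable on `[0, ∞)`. -/
def IsL2 {κ : Type*} (u : ℝ → κ → ℝ) : Prop :=
  ∀ i, MemLp (fun t => u t i) 2 (volume.restrict (Set.Ici (0 : ℝ)))

section IsL2

variable {ι κ : Type*} [Fintype κ]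

theorem IsL2.add {u v : ℝ → ι → ℝ} (hu : IsL2 u) (hv : IsL2 v) : IsL2 (fun t => u t + v t) :=
  fun i => (hu i).add (hv i)

theorem IsL2.mulVec {u : ℝ → κ → ℝ} (hu : IsL2 u) (M : Matrix ι κ ℝ) :
    IsL2 (fun t => M *ᵥ u t) := fun i => by
  simp only [Matrix.mulVec, dotProduct]
  exact memLp_finsetSum _ fun j _ => (hu j).const_mul (M i j)

theorem IsL2.intervalIntegrable {u : ℝ → ι → ℝ} (hu : IsL2 u) (i : ι) (T : ℝ) (hT : 0 ≤ T) :
    IntervalIntegrable (fun t => u t i) volume 0 T := by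
  rw [intervalIntegrable_iff_integrableOn_Ioc_of_le hT]
  have h : MemLp (fun t => u t i) 2 (volume.restrict (Set.Ioc 0 T)) :=
    (hu i).mono_measure (Measure.restrict_mono (fun t ht => ht.1.le) le_rfl)
  exact h.integrable (by norm_num)

theorem IsL2.integrable_dotProduct {u v : ℝ → κ → ℝ} (hu : IsL2 u) (hv : IsL2 v) :
    IntegrableOn (fun t => u t ⬝ᵥ v t) (Set.Ici 0) :=
  integrable_finsetSum _ fun i _ => (hu i).integrable_mul (hv i)

theorem isL2_of_expDecay {u : ℝ → κ → ℝ} (h : ExpDecay u) (hc : ContinuousOn u (Set.Ici 0)) :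
    IsL2 u := by
  intro i
  have hm : AEStronglyMeasurable (fun t => u t i) (volume.restrict (Set.Ici (0 : ℝ))) :=
    ((continuous_apply i).comp_continuousOn hc).aestronglyMeasurable measurableSet_Ici
  have hi : ExpDecay fun t => u t i := h.of_norm_le 1 fun t _ => by
    rw [one_mul]; exact norm_le_pi_norm (u t) i
  rw [memLp_two_iff_integrable_sq hm]
  simp only [pow_two]
  exact (hi.mul hi).integrableOn (hm.mul hm)

theorem tendsto_integral_Ici {f : ℝ → ℝ} (hf : IntegrableOn f (Set.Ici 0)) :
    Tendsto (fun T => ∫ t in (0 : ℝ)..T, f t) atTop (𝓝 (∫ t in Set.Ici 0, f t)) := by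
  rw [integral_Ici_eq_integral_Ioi]
  exact intervalIntegral_tendsto_integral_Ioi 0 (hf.mono_set Set.Ioi_subset_Ici_self) tendsto_id

end IsL2

theorem isL2_ofLp_iff {u : ℝ → EuclideanSpace ℝ (Fin m)} :
    IsL2 (fun t => (u t).ofLp) ↔ MemLp u 2 (volume.restrict (Set.Ici (0 : ℝ))) := by
  constructor
  · intro h
    have hm : AEStronglyMeasurable u (volume.restrict (Set.Ici (0 : ℝ))) := by
      have h1 : AEStronglyMeasurable (fun t => (u t).ofLp) (volume.restrict (Set.Ici (0 : ℝ))) :=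
        (aemeasurable_pi_lambda _ fun i => (h i).1.aemeasurable).aestronglyMeasurable
      exact (PiLp.continuous_toLp 2 (fun _ : Fin m => ℝ)).comp_aestronglyMeasurable h1
    rw [memLp_two_iff_integrable_sq_norm hm]
    simp only [EuclideanSpace.real_norm_sq_eq]
    exact integrable_finsetSum _ fun i _ => (h i).integrable_sq
  · intro h i
    refine MemLp.of_le h ?_ (Eventually.of_forall fun t => PiLp.norm_apply_le (u t) i)
    exact ((continuous_apply i).comp (PiLp.continuous_ofLp 2 (fun _ : Fin m => ℝ))
      ).comp_aestronglyMeasurable h.1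

theorem energy_eq (u : ℝ → EuclideanSpace ℝ (Fin m)) :
    energy u = ∫ t in Set.Ici (0 : ℝ), (u t).ofLp ⬝ᵥ (u t).ofLp := by
  have h : ∀ t, ‖u t‖ ^ 2 = (u t).ofLp ⬝ᵥ (u t).ofLp := fun t => by
    rw [EuclideanSpace.real_norm_sq_eq]
    simp only [dotProduct, pow_two]
  simp only [energy, h]

/-- Square integrability of `u` gives local integrability of the right side. Without it the vector
integral could be zero by convention and would not split into components. -/
theorem isTrajectory_iff {A : Matrix (Fin n) (Fin n) ℝ} {B : Matrix (Fin n) (Fin m) ℝ}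
    {x₀ : Fin n → ℝ} {u : ℝ → EuclideanSpace ℝ (Fin m)} {x : ℝ → Fin n → ℝ}
    (hu : IsL2 (fun t => (u t).ofLp)) :
    IsTrajectory A B x₀ u x ↔
      x 0 = x₀ ∧ IsVecPrimitive x (fun t => A *ᵥ x t + B *ᵥ (u t).ofLp) := by
  have hint : ContinuousOn x (Set.Ici 0) → ∀ T : ℝ, 0 ≤ T → ∀ i,
      IntervalIntegrable (fun t => (A *ᵥ x t + B *ᵥ (u t).ofLp) i) volume 0 T := by
    intro hx T hT i
    have h1 : ContinuousOn (fun t => (A *ᵥ x t) i) (Set.uIcc 0 T) := by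
      rw [Set.uIcc_of_le hT]
      have h2 : Continuous fun y : Fin n → ℝ => (A *ᵥ y) i :=
        (continuous_apply i).comp (continuous_const.matrix_mulVec continuous_id)
      exact h2.comp_continuousOn (hx.mono fun t ht => ht.1)
    exact h1.intervalIntegrable.add ((hu.mulVec B).intervalIntegrable i T hT)
  have happ : ContinuousOn x (Set.Ici 0) → ∀ T : ℝ, 0 ≤ T → ∀ i,
      (∫ s in (0 : ℝ)..T, (A *ᵥ x s + B *ᵥ (u s).ofLp)) i
        = ∫ s in (0 : ℝ)..T, (A *ᵥ x s + B *ᵥ (u s).ofLp) i := by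
    intro hx T hT i
    have h1 : IntervalIntegrable (fun s => A *ᵥ x s + B *ᵥ (u s).ofLp) volume 0 T := by
      rw [intervalIntegrable_iff_integrableOn_Ioc_of_le hT]
      refine Integrable.of_eval fun i => ?_
      exact (intervalIntegrable_iff_integrableOn_Ioc_of_le hT).1 (hint hx T hT i)
    exact ((ContinuousLinearMap.proj (R := ℝ) (φ := fun _ : Fin n => ℝ) i
      ).intervalIntegral_comp_comm h1).symm
  constructor
  · rintro ⟨hx, h⟩
    have h0 : x 0 = x₀ := by simpa using h 0 le_rfl
    refine ⟨h0, fun i => ⟨fun T hT => hint hx T hT i, fun T hT => ?_⟩⟩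
    beta_reduce
    rw [h T hT, Pi.add_apply, happ hx T hT, h0]
  · rintro ⟨h0, h⟩
    refine ⟨h.continuousOn, fun T hT => ?_⟩
    ext i
    rw [Pi.add_apply, happ h.continuousOn T hT, ← h0]
    exact (h i).2 T hT

/-- The integrated equation does not see null sets, so a feedback law valid almost everywhere
already gives the closed-loop equation, whose solution is unique. -/
theorem IsTrajectory.congr_ae {A : Matrix (Fin n) (Fin n) ℝ} {B : Matrix (Fin n) (Fin m) ℝ}
    {x₀ : Fin n → ℝ} {u : ℝ → EuclideanSpace ℝ (Fin m)} {x : ℝ → Fin n → ℝ}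
    {K : Matrix (Fin n) (Fin n) ℝ} (hu : IsL2 (fun t => (u t).ofLp))
    (hx : IsTrajectory A B x₀ u x)
    (h : (fun t => (u t).ofLp) =ᵐ[volume.restrict (Set.Ici (0 : ℝ))]
      fun t => -(Bᵀ *ᵥ (K *ᵥ x t))) {t : ℝ} (ht : 0 ≤ t) :
    x t = flow (A - B * Bᵀ * K) x₀ t := by
  obtain ⟨h0, hp⟩ := (isTrajectory_iff hu).1 hx
  rw [← h0]
  refine IsVecPrimitive.eq_flow (hp.congr_ae ?_) ht
  filter_upwards [h] with s hs
  rw [hs, Matrix.sub_mulVec, Matrix.mulVec_neg, ← sub_eq_add_neg]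
  simp only [Matrix.mulVec_mulVec, Matrix.mul_assoc]

/-! ### Completing the square -/

/-- The left side is the derivative of `xᵀ K x` along the control system. The Riccati equation turns
its part quadratic in `x` into `|Bᵀ K x|²`, the term missing from the square. -/
theorem IsRiccatiSolution.deriv_quadratic {A : Matrix (Fin n) (Fin n) ℝ}
    {B : Matrix (Fin n) (Fin m) ℝ} {K : Matrix (Fin n) (Fin n) ℝ} (hK : IsRiccatiSolution A B K)
    (x : Fin n → ℝ) (v : Fin m → ℝ) :
    (A *ᵥ x + B *ᵥ v) ⬝ᵥ (K *ᵥ x) + x ⬝ᵥ (K *ᵥ (A *ᵥ x + B *ᵥ v))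
      = (v + Bᵀ *ᵥ (K *ᵥ x)) ⬝ᵥ (v + Bᵀ *ᵥ (K *ᵥ x)) - v ⬝ᵥ v := by
  have h1 : (A *ᵥ x) ⬝ᵥ (K *ᵥ x) + x ⬝ᵥ (K *ᵥ (A *ᵥ x))
      = (Bᵀ *ᵥ (K *ᵥ x)) ⬝ᵥ (Bᵀ *ᵥ (K *ᵥ x)) := by
    have h2 : (A *ᵥ x) ⬝ᵥ (K *ᵥ x) = x ⬝ᵥ ((Aᵀ * K) *ᵥ x) := by
      rw [← Matrix.mulVec_mulVec, Matrix.dotProduct_mulVec x, Matrix.vecMul_transpose]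
    have h3 : (Bᵀ *ᵥ (K *ᵥ x)) ⬝ᵥ (Bᵀ *ᵥ (K *ᵥ x)) = x ⬝ᵥ ((K * B * Bᵀ * K) *ᵥ x) := by
      have h4 : Bᵀ *ᵥ (K *ᵥ x) = x ᵥ* (K * B) := by
        rw [Matrix.mulVec_mulVec, ← Matrix.mulVec_transpose, Matrix.transpose_mul, hK.symm]
      conv_lhs => rw [h4]
      rw [← Matrix.dotProduct_mulVec]
      simp only [h4.symm, Matrix.mulVec_mulVec, Matrix.mul_assoc]
    rw [h2, h3, ← hK.riccati, Matrix.add_mulVec, dotProduct_add, Matrix.mulVec_mulVec]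
  have h5 : (B *ᵥ v) ⬝ᵥ (K *ᵥ x) = v ⬝ᵥ (Bᵀ *ᵥ (K *ᵥ x)) := by
    rw [Matrix.dotProduct_mulVec v, Matrix.vecMul_transpose]
  have h6 : x ⬝ᵥ (K *ᵥ (B *ᵥ v)) = v ⬝ᵥ (Bᵀ *ᵥ (K *ᵥ x)) := by
    rw [Matrix.dotProduct_mulVec, ← Matrix.mulVec_transpose, hK.symm, dotProduct_comm, h5]
  rw [Matrix.mulVec_add, add_dotProduct, dotProduct_add, h5, h6, add_dotProduct, dotProduct_add,
    dotProduct_add, ← h1, dotProduct_comm (Bᵀ *ᵥ (K *ᵥ x)) v]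
  ring

section Square

variable {A : Matrix (Fin n) (Fin n) ℝ} {B : Matrix (Fin n) (Fin m) ℝ}
  {K : Matrix (Fin n) (Fin n) ℝ} {x₀ : Fin n → ℝ} {u : ℝ → EuclideanSpace ℝ (Fin m)}
  {x : ℝ → Fin n → ℝ}

theorem IsRiccatiSolution.isPrimitive_quadratic (hK : IsRiccatiSolution A B K)
    (hu : IsL2 (fun t => (u t).ofLp)) (hx : IsTrajectory A B x₀ u x) :
    IsPrimitive (fun t => x t ⬝ᵥ (K *ᵥ x t)) (fun t =>
      ((u t).ofLp + Bᵀ *ᵥ (K *ᵥ x t)) ⬝ᵥ ((u t).ofLp + Bᵀ *ᵥ (K *ᵥ x t))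
        - (u t).ofLp ⬝ᵥ (u t).ofLp) := by
  obtain ⟨-, hp⟩ := (isTrajectory_iff hu).1 hx
  have := hp.dotProduct (hp.mulVec K)
  simpa only [hK.deriv_quadratic] using this

theorem intervalIntegrable_of_Ici {f : ℝ → ℝ} (hf : IntegrableOn f (Set.Ici 0)) {T : ℝ}
    (hT : 0 ≤ T) : IntervalIntegrable f volume 0 T :=
  (intervalIntegrable_iff_integrableOn_Ioc_of_le hT).2 (hf.mono_set fun _ ht => ht.1.le)

theorem tendsto_dotProduct_mulVec (hx : Tendsto x atTop (𝓝 0)) (K : Matrix (Fin n) (Fin n) ℝ) :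
    Tendsto (fun t => x t ⬝ᵥ (K *ᵥ x t)) atTop (𝓝 0) := by
  have hc : Continuous fun y : Fin n → ℝ => y ⬝ᵥ (K *ᵥ y) :=
    continuous_id.dotProduct (continuous_const.matrix_mulVec continuous_id)
  have := (hc.tendsto 0).comp hx
  rw [zero_dotProduct] at this
  exact this

/-- The excess of the energy over `x₀ᵀ K x₀` is the energy of `u + Bᵀ K x`. -/
theorem IsRiccatiSolution.tendsto_excess (hK : IsRiccatiSolution A B K)
    (hu : IsL2 (fun t => (u t).ofLp)) (hx : IsTrajectory A B x₀ u x)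
    (hx0 : Tendsto x atTop (𝓝 0)) :
    (∀ T : ℝ, 0 ≤ T → IntervalIntegrable (fun t => ((u t).ofLp + Bᵀ *ᵥ (K *ᵥ x t)) ⬝ᵥ
      ((u t).ofLp + Bᵀ *ᵥ (K *ᵥ x t))) volume 0 T) ∧
    Tendsto (fun T => ∫ t in (0 : ℝ)..T, ((u t).ofLp + Bᵀ *ᵥ (K *ᵥ x t)) ⬝ᵥ
      ((u t).ofLp + Bᵀ *ᵥ (K *ᵥ x t))) atTop (𝓝 (energy u - x₀ ⬝ᵥ (K *ᵥ x₀))) := by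
  have hq := hK.isPrimitive_quadratic hu hx
  have hxx := ((isTrajectory_iff hu).1 hx).1
  have huu := hu.integrable_dotProduct hu
  have hi : ∀ T : ℝ, 0 ≤ T → IntervalIntegrable (fun t => ((u t).ofLp + Bᵀ *ᵥ (K *ᵥ x t)) ⬝ᵥ
      ((u t).ofLp + Bᵀ *ᵥ (K *ᵥ x t))) volume 0 T := fun T hT => by
    have := (hq.1 T hT).add (intervalIntegrable_of_Ici huu hT)
    exact this.congr (fun _ _ => by simp)
  refine ⟨hi, ?_⟩
  -- The state is not known to be square integrable, so the excess is obtained as a limit over `[0,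
  -- T]`; the boundary term `x(T)ᵀ K x(T)` disappears because the state tends to zero.
  have hlim := ((tendsto_dotProduct_mulVec hx0 K).sub_const (x₀ ⬝ᵥ (K *ᵥ x₀))).add
    (tendsto_integral_Ici huu)
  rw [← energy_eq, zero_sub, neg_add_eq_sub] at hlim
  refine hlim.congr' ?_
  filter_upwards [eventually_ge_atTop 0] with T hT
  have h1 := hq.2 T hT
  beta_reduce at h1
  rw [intervalIntegral.integral_sub (hi T hT) (intervalIntegrable_of_Ici huu hT), hxx] at h1
  rw [h1]; ring

theorem ae_eq_neg_of_forall_integral_eq_zero {v w : ℝ → Fin m → ℝ}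
    (hi : ∀ T : ℝ, 0 ≤ T → IntervalIntegrable (fun t => (v t + w t) ⬝ᵥ (v t + w t)) volume 0 T)
    (h : ∀ T : ℝ, 0 ≤ T → ∫ t in (0 : ℝ)..T, (v t + w t) ⬝ᵥ (v t + w t) = 0) :
    v =ᵐ[volume.restrict (Set.Ici (0 : ℝ))] fun t => -w t := by
  have hn : ∀ y : Fin m → ℝ, 0 ≤ y ⬝ᵥ y := fun y =>
    Finset.sum_nonneg fun _ _ => mul_self_nonneg _
  have h1 : ∀ N : ℕ, v =ᵐ[volume.restrict (Set.Ioc 0 (N : ℝ))] fun t => -w t := by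
    intro N
    have h2 := h N N.cast_nonneg
    rw [intervalIntegral.integral_of_le N.cast_nonneg, setIntegral_eq_zero_iff_of_nonneg_ae
      (Eventually.of_forall fun t => hn _)
      ((intervalIntegrable_iff_integrableOn_Ioc_of_le N.cast_nonneg).1 (hi N N.cast_nonneg))] at h2
    filter_upwards [h2] with t ht
    exact eq_neg_of_add_eq_zero_left (dotProduct_self_eq_zero.1 ht)
  rw [← restrict_Ioi_eq_restrict_Ici]
  have h3 : Set.Ioi (0 : ℝ) = ⋃ N : ℕ, Set.Ioc 0 (N : ℝ) := by
    ext t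
    simp only [Set.mem_Ioi, Set.mem_iUnion, Set.mem_Ioc]
    exact ⟨fun ht => ⟨_, ht, (Nat.le_ceil t)⟩, fun ⟨_, ht, _⟩ => ht⟩
  rw [h3]
  exact (ae_restrict_iUnion_iff _ _).2 h1

theorem integral_dotProduct_self_mono {f : ℝ → Fin m → ℝ}
    (hi : ∀ T : ℝ, 0 ≤ T → IntervalIntegrable (fun t => f t ⬝ᵥ f t) volume 0 T) {S T : ℝ}
    (hS : 0 ≤ S) (hST : S ≤ T) :
    ∫ t in (0 : ℝ)..S, f t ⬝ᵥ f t ≤ ∫ t in (0 : ℝ)..T, f t ⬝ᵥ f t :=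
  intervalIntegral.integral_mono_interval le_rfl hS hST
    (Eventually.of_forall fun _ => Finset.sum_nonneg fun _ _ => mul_self_nonneg _)
    (hi T (hS.trans hST))

theorem IsRiccatiSolution.le_energy (hK : IsRiccatiSolution A B K) (hu : u ∈ admissible A B x₀) :
    x₀ ⬝ᵥ (K *ᵥ x₀) ≤ energy u := by
  obtain ⟨hu, x, hx, hx0⟩ := hu
  obtain ⟨hi, hlim⟩ := hK.tendsto_excess (isL2_ofLp_iff.2 hu) hx hx0
  have : 0 ≤ energy u - x₀ ⬝ᵥ (K *ᵥ x₀) := by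
    refine ge_of_tendsto hlim ?_
    filter_upwards [eventually_ge_atTop 0] with T hT
    simpa using integral_dotProduct_self_mono hi le_rfl hT
  linarith

/-- The integrals of `|u + Bᵀ K x|²` over `[0, S]` are nonnegative, increase with `S` and tend to
zero, so all of them vanish. -/
theorem IsRiccatiSolution.ae_eq_of_energy_eq (hK : IsRiccatiSolution A B K)
    (hu : IsL2 (fun t => (u t).ofLp)) (hx : IsTrajectory A B x₀ u x)
    (hx0 : Tendsto x atTop (𝓝 0)) (he : energy u = x₀ ⬝ᵥ (K *ᵥ x₀)) :
    (fun t => (u t).ofLp) =ᵐ[volume.restrict (Set.Ici (0 : ℝ))]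
      fun t => -(Bᵀ *ᵥ (K *ᵥ x t)) := by
  obtain ⟨hi, hlim⟩ := hK.tendsto_excess hu hx hx0
  rw [he, sub_self] at hlim
  refine ae_eq_neg_of_forall_integral_eq_zero hi fun S hS => le_antisymm ?_ ?_
  · refine ge_of_tendsto hlim ?_
    filter_upwards [eventually_ge_atTop S] with T hT
    exact integral_dotProduct_self_mono hi hS hT
  · simpa using integral_dotProduct_self_mono hi le_rfl hS

theorem IsRiccatiSolution.energy_feedback (hK : IsRiccatiSolution A B K)
    (hu : IsL2 (fun t => (u t).ofLp)) (hx : IsTrajectory A B x₀ u x)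
    (hx0 : Tendsto x atTop (𝓝 0))
    (h : ∀ t, 0 ≤ t → (u t).ofLp = -(Bᵀ *ᵥ (K *ᵥ x t))) : energy u = x₀ ⬝ᵥ (K *ᵥ x₀) := by
  obtain ⟨-, hlim⟩ := hK.tendsto_excess hu hx hx0
  have h0 : Tendsto (fun T => ∫ t in (0 : ℝ)..T, ((u t).ofLp + Bᵀ *ᵥ (K *ᵥ x t)) ⬝ᵥ
      ((u t).ofLp + Bᵀ *ᵥ (K *ᵥ x t))) atTop (𝓝 0) := by
    refine tendsto_const_nhds.congr' ?_
    filter_upwards [eventually_ge_atTop 0] with T hT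
    rw [intervalIntegral.integral_congr (g := fun _ => 0), intervalIntegral.integral_zero]
    intro t ht
    rw [Set.uIcc_of_le hT] at ht
    simp [h t ht.1]
  have := tendsto_nhds_unique hlim h0
  linarith

end Square

end Control

/-! ### The adjoint state -/

section Adjoint

variable {n m : ℕ}

theorem tendsto_tail_integral {f : ℝ → ℝ} (hf : IntegrableOn f (Set.Ici 0)) :
    Tendsto (fun s => ∫ t in Set.Ioi s, f t) atTop (𝓝 0) := by
  have h1 := (tendsto_integral_Ici hf).const_sub (∫ t in Set.Ici 0, f t)
  rw [sub_self] at h1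
  refine h1.congr' ?_
  filter_upwards [eventually_ge_atTop 0] with s hs
  have h2 := intervalIntegral.integral_Ioi_sub_Ioi (hf.mono_set Set.Ioi_subset_Ici_self)
    hs
  rw [integral_Ici_eq_integral_Ioi, ← h2]
  ring

/-- The convolution of a square integrable function with an exponentially decaying kernel tends to
zero. -/
theorem tendsto_convolution {e w : ℝ → ℝ} (he : ExpDecay e)
    (hw : MemLp w 2 (volume.restrict (Set.Ici (0 : ℝ)))) :
    Tendsto (fun s => ∫ t in Set.Ioi s, e (t - s) * w t) atTop (𝓝 0) := by
  obtain ⟨C, c, hc, hC⟩ := he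
  have hw2 : IntegrableOn (fun t => w t ^ 2) (Set.Ici 0) := hw.integrable_sq
  have htail := tendsto_tail_integral hw2
  have hC0 : 0 ≤ C := by simpa using (norm_nonneg _).trans (hC 0 le_rfl)
  -- Young's inequality with weight `δ` separates kernel and function: the squared kernel
  -- contributes a bound independent of `s`, and the function contributes its square-integral tail.
  have hbound : ∀ δ : ℝ, 0 < δ → ∀ s : ℝ, 0 ≤ s → ‖∫ t in Set.Ioi s, e (t - s) * w t‖ ≤
      δ * (C ^ 2 / (2 * c)) + δ⁻¹ * ∫ t in Set.Ioi s, w t ^ 2 := by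
    intro δ hδ s hs
    have hexp : IntegrableOn (fun t : ℝ => Real.exp (-(2 * c) * t)) (Set.Ioi s) :=
      integrableOn_exp_mul_Ioi (by linarith) s
    have hg : IntegrableOn (fun t => δ * C ^ 2 * Real.exp (2 * c * s) * Real.exp (-(2 * c) * t)
        + δ⁻¹ * w t ^ 2) (Set.Ioi s) :=
      (hexp.const_mul _).add ((hw2.mono_set fun t ht => hs.trans (le_of_lt ht)).const_mul _)
    refine (norm_integral_le_of_norm_le hg ?_).trans (le_of_eq ?_)
    · filter_upwards [ae_restrict_mem measurableSet_Ioi] with t ht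
      have h1 := hC (t - s) (sub_nonneg.2 (le_of_lt ht))
      have h2 : Real.exp (2 * c * s) * Real.exp (-(2 * c) * t) = Real.exp (-c * (t - s)) ^ 2 := by
        rw [← Real.exp_add, ← Real.exp_nat_mul]; congr 1; push_cast; ring
      rw [norm_mul, mul_assoc _ (Real.exp (2 * c * s)), h2]
      set E := Real.exp (-c * (t - s)) with hE
      have hE0 : 0 ≤ C * E := (norm_nonneg _).trans h1
      have h3 : ‖e (t - s)‖ * ‖w t‖ ≤ C * E * |w t| := by
        rw [Real.norm_eq_abs (w t)]; gcongr
      have h4 : C * E * |w t| ≤ δ * (C * E) ^ 2 + δ⁻¹ * |w t| ^ 2 := by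
        have h5 : 0 ≤ δ⁻¹ * (δ * (C * E) - |w t|) ^ 2 := by positivity
        have h6 : δ⁻¹ * (δ * (C * E) - |w t|) ^ 2
            = δ * (C * E) ^ 2 + δ⁻¹ * |w t| ^ 2 - 2 * (C * E * |w t|) := by field_simp; ring
        have h7 : 0 ≤ C * E * |w t| := by positivity
        linarith
      rw [sq_abs, mul_pow] at h4
      linarith
    · rw [integral_add (hexp.const_mul _)
        ((hw2.mono_set fun t ht => hs.trans (le_of_lt ht)).const_mul _), integral_const_mul,
        integral_const_mul, integral_exp_mul_Ioi (by linarith)]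
      congr 1
      have : Real.exp (2 * c * s) * Real.exp (-(2 * c) * s) = 1 := by
        rw [← Real.exp_add]; simp
      calc δ * C ^ 2 * Real.exp (2 * c * s) * (-Real.exp (-(2 * c) * s) / -(2 * c))
          = δ * (C ^ 2 / (2 * c)) * (Real.exp (2 * c * s) * Real.exp (-(2 * c) * s)) := by
            field_simp
        _ = _ := by rw [this, mul_one]
  rw [Metric.tendsto_atTop]
  intro ε hε
  -- This makes the kernel term at most `ε / 2`; the `+ 1` keeps the denominator positive when `C =
  -- 0`.
  set δ := ε / (2 * (C ^ 2 / (2 * c) + 1)) with hδ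
  have hD : 0 < C ^ 2 / (2 * c) + 1 := by positivity
  have hδ0 : 0 < δ := by positivity
  obtain ⟨s₀, hs₀⟩ := (Metric.tendsto_atTop.1 htail) (δ * (ε / 2)) (by positivity)
  refine ⟨max s₀ 0, fun s hs => ?_⟩
  have h1 := hs₀ s ((le_max_left _ _).trans hs)
  have h2 := hbound δ hδ0 s ((le_max_right _ _).trans hs)
  rw [Real.dist_eq, sub_zero] at h1
  rw [dist_zero_right]
  have h3 : δ⁻¹ * ∫ t in Set.Ioi s, w t ^ 2 < ε / 2 := by
    rw [inv_mul_lt_iff₀ hδ0]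
    exact (le_abs_self _).trans_lt h1
  have h4 : δ * (C ^ 2 / (2 * c)) ≤ ε / 2 := by
    have h5 : δ * (C ^ 2 / (2 * c) + 1) = ε / 2 := by rw [hδ]; field_simp
    nlinarith
  linarith

theorem IsHurwitz.expDecay_exp_apply {N : Matrix (Fin n) (Fin n) ℝ} (hN : IsHurwitz N)
    (i j : Fin n) : ExpDecay (fun t : ℝ => NormedSpace.exp (t • N) i j) := by
  refine (hN.expDecay_flow (Pi.single j 1)).of_norm_le 1 fun t _ => ?_
  have : NormedSpace.exp (t • N) i j = flow N (Pi.single j 1) t i := by simp [flow]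
  rw [this, one_mul]
  exact norm_le_pi_norm _ i

/-- For Hurwitz `M` and square integrable `v`, the equation `p' = -M p - v` has a solution that
tends to zero. -/
theorem exists_adjoint {M : Matrix (Fin n) (Fin n) ℝ} (hM : IsHurwitz M) {v : ℝ → Fin n → ℝ}
    (hv : IsL2 v) :
    ∃ p : ℝ → Fin n → ℝ, IsVecPrimitive p (fun t => (-M) *ᵥ p t + -v t) ∧
      Tendsto p atTop (𝓝 0) := by
  have hE : ∀ i j, MemLp (fun t : ℝ => NormedSpace.exp (t • M) i j) 2
      (volume.restrict (Set.Ici (0 : ℝ))) := fun i j => by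
    have h : IsL2 (fun (t : ℝ) (_ : Fin 1) => NormedSpace.exp (t • M) i j) :=
      isL2_of_expDecay ((hM.expDecay_exp_apply i j).of_norm_le 1 fun t _ => by
        rw [one_mul]
        exact pi_norm_const_le _)
        (continuous_pi fun _ => (continuous_exp_smul M).matrix_elem i j).continuousOn
    exact h 0
  have hint : ∀ i, IntegrableOn (fun t => (NormedSpace.exp (t • M) *ᵥ v t) i) (Set.Ici 0) :=
    fun i => integrable_finsetSum Finset.univ fun j _ => (hE i j).integrable_mul (hv j)
  -- With this initial value, variation of constants becomes `p(s) = ∫ exp((t - s) M) v(t) dt` over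
  -- `t > s`, a convolution with a decaying kernel.
  set p₀ : Fin n → ℝ := fun i => ∫ t in Set.Ici 0, (NormedSpace.exp (t • M) *ᵥ v t) i with hp₀
  refine ⟨forcedFlow (-M) p₀ (fun t => -v t), isVecPrimitive_forcedFlow _ _ fun i T hT =>
    (hv.intervalIntegrable i T hT).neg, ?_⟩
  rw [tendsto_pi_nhds]
  intro i
  have h1 : Tendsto (fun s => ∑ j, ∫ t in Set.Ioi s, NormedSpace.exp ((t - s) • M) i j * v t j)
      atTop (𝓝 0) := by
    have := tendsto_finsetSum Finset.univ fun j (_ : j ∈ Finset.univ) =>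
      tendsto_convolution (hM.expDecay_exp_apply i j) (hv j)
    simpa using this
  refine h1.congr' ?_
  filter_upwards [eventually_ge_atTop 0] with s hs
  have htail : ∀ k, p₀ k + ∫ t in (0 : ℝ)..s, (NormedSpace.exp ((-t) • (-M)) *ᵥ (-v t)) k
      = ∫ t in Set.Ioi s, (NormedSpace.exp (t • M) *ᵥ v t) k := by
    intro k
    have h2 := intervalIntegral.integral_Ioi_sub_Ioi ((hint k).mono_set Set.Ioi_subset_Ici_self) hs
    have h3 : ∀ t : ℝ, (NormedSpace.exp ((-t) • (-M)) *ᵥ (-v t)) k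
        = -(NormedSpace.exp (t • M) *ᵥ v t) k := fun t => by
      rw [Matrix.mulVec_neg, Pi.neg_apply]; simp
    simp only [h3, intervalIntegral.integral_neg]
    rw [← h2, hp₀, ← integral_Ici_eq_integral_Ioi]
    ring
  rw [forcedFlow]
  simp only [htail]
  have hIoi : ∀ k, IntegrableOn (fun t => (NormedSpace.exp (t • M) *ᵥ v t) k) (Set.Ioi s) :=
    fun k => (hint k).mono_set fun t ht => hs.trans (le_of_lt ht)
  have hflow : flow (-M) (fun k => ∫ t in Set.Ioi s, (NormedSpace.exp (t • M) *ᵥ v t) k) s i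
      = ∫ t in Set.Ioi s, (NormedSpace.exp ((t - s) • M) *ᵥ v t) i := by
    have h4 : ∀ t : ℝ, (NormedSpace.exp ((t - s) • M) *ᵥ v t) i
        = ∑ k, NormedSpace.exp (s • (-M)) i k * (NormedSpace.exp (t • M) *ᵥ v t) k := fun t => by
      have h5 : t - s = -s + t := by ring
      rw [h5, exp_add_smul, ← Matrix.mulVec_mulVec]
      simp [Matrix.mulVec, dotProduct]
    simp only [h4]
    rw [integral_finsetSum _ fun k _ => (hIoi k).const_mul _]
    simp only [integral_const_mul]
    rfl
  rw [hflow]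
  simp only [Matrix.mulVec, dotProduct]
  rw [integral_finsetSum]
  intro j _
  have h6 : IntegrableOn (fun t => ∑ k, NormedSpace.exp (s • (-M)) i k *
      (NormedSpace.exp (t • M) k j * v t j)) (Set.Ioi s) :=
    integrable_finsetSum _ fun k _ => (((hE k j).integrable_mul (hv j)).mono_measure
      (Measure.restrict_mono (fun t ht => hs.trans (le_of_lt ht)) le_rfl)).const_mul _
  refine h6.congr (Eventually.of_forall fun t => ?_)
  have h5 : t - s = -s + t := by ring
  beta_reduce
  rw [h5, exp_add_smul, Matrix.mul_apply, Finset.sum_mul]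
  exact Finset.sum_congr rfl fun k _ => by simp [mul_assoc]

end Adjoint

/-! ### The first variation -/

section Variation

variable {n m : ℕ} {A : Matrix (Fin n) (Fin n) ℝ} {B : Matrix (Fin n) (Fin m) ℝ}
  {K : Matrix (Fin n) (Fin n) ℝ} {x₀ : Fin n → ℝ} {u : ℝ → EuclideanSpace ℝ (Fin m)}

theorem eq_zero_of_forall_quadratic_nonneg {a b : ℝ} (h : ∀ ε : ℝ, 0 ≤ 2 * ε * a + ε ^ 2 * b) :
    a = 0 := by
  have hb : 0 < |b| + 1 := by positivity
  -- The extremal choice would be `-a / b`; `|b| + 1` is positive whatever the value of `b`.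
  have h1 := h (-a / (|b| + 1))
  have h2 : 2 * (-a / (|b| + 1)) * a + (-a / (|b| + 1)) ^ 2 * b
      = -(a ^ 2 * (2 * (|b| + 1) - b)) / (|b| + 1) ^ 2 := by
    field_simp; ring
  rw [h2, le_div_iff₀ (by positivity), zero_mul] at h1
  have h3 : 0 < 2 * (|b| + 1) - b := by linarith [le_abs_self b, abs_nonneg b]
  have h4 : a ^ 2 ≤ 0 := by
    by_contra h5
    have := mul_pos (not_le.1 h5) h3
    linarith
  exact pow_eq_zero_iff (two_ne_zero) |>.1 (le_antisymm h4 (sq_nonneg a))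

/-- A minimizer is orthogonal to all controls that are admissible from the origin. -/
theorem IsMinimizer.orthogonal (hu : IsMinimizer A B x₀ u) {r : ℝ → Fin m → ℝ} (hr : IsL2 r)
    {ξ : ℝ → Fin n → ℝ} (hξ : IsVecPrimitive ξ (fun t => A *ᵥ ξ t + B *ᵥ r t)) (h0 : ξ 0 = 0)
    (hlim : Tendsto ξ atTop (𝓝 0)) :
    ∫ t in Set.Ici (0 : ℝ), (u t).ofLp ⬝ᵥ r t = 0 := by
  obtain ⟨⟨hu2, x, hx, hx0⟩, hmin⟩ := hu
  have huL := isL2_ofLp_iff.2 hu2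
  obtain ⟨hxx, hp⟩ := (isTrajectory_iff huL).1 hx
  refine eq_zero_of_forall_quadratic_nonneg (b := ∫ t in Set.Ici (0 : ℝ), r t ⬝ᵥ r t) fun ε => ?_
  set w : ℝ → EuclideanSpace ℝ (Fin m) := fun t => WithLp.toLp 2 ((u t).ofLp + ε • r t) with hw
  have hεr : IsL2 (fun t => ε • r t) := fun i => (hr i).const_mul ε
  have hwL : IsL2 (fun t => (w t).ofLp) := huL.add hεr
  have hadm : w ∈ admissible A B x₀ := by
    refine ⟨isL2_ofLp_iff.1 hwL, fun t => x t + ε • ξ t, (isTrajectory_iff hwL).2 ⟨?_, ?_⟩, ?_⟩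
    · simp [hxx, h0]
    · have h1 : IsVecPrimitive (fun t => ε • ξ t) (fun t => ε • (A *ᵥ ξ t + B *ᵥ r t)) :=
        fun i => (hξ i).const_mul ε
      have h2 := hp.add h1
      have h3 : (fun t => A *ᵥ x t + B *ᵥ (u t).ofLp + ε • (A *ᵥ ξ t + B *ᵥ r t))
          = fun t => A *ᵥ (x t + ε • ξ t) + B *ᵥ (w t).ofLp := by
        funext t
        simp only [hw, Matrix.mulVec_add, Matrix.mulVec_smul, smul_add]
        abel
      rwa [h3] at h2
    · simpa using hx0.add (hlim.const_smul ε)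
  have h := hmin w hadm
  have he : energy w = energy u + 2 * ε * (∫ t in Set.Ici (0 : ℝ), (u t).ofLp ⬝ᵥ r t)
      + ε ^ 2 * ∫ t in Set.Ici (0 : ℝ), r t ⬝ᵥ r t := by
    have h1 : ∀ t, (w t).ofLp ⬝ᵥ (w t).ofLp = (u t).ofLp ⬝ᵥ (u t).ofLp
        + 2 * ε * ((u t).ofLp ⬝ᵥ r t) + ε ^ 2 * (r t ⬝ᵥ r t) := fun t => by
      simp only [hw, add_dotProduct, dotProduct_add, smul_dotProduct, dotProduct_smul, smul_eq_mul]
      rw [dotProduct_comm (r t) (u t).ofLp]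
      ring
    rw [energy_eq, energy_eq]
    simp only [h1]
    have h2 : IntegrableOn (fun t => (u t).ofLp ⬝ᵥ (u t).ofLp + 2 * ε * ((u t).ofLp ⬝ᵥ r t))
        (Set.Ici 0) := (huL.integrable_dotProduct huL).add
      ((huL.integrable_dotProduct hr).const_mul _)
    rw [integral_add h2 ((hr.integrable_dotProduct hr).const_mul _),
      integral_add (huL.integrable_dotProduct huL) ((huL.integrable_dotProduct hr).const_mul _),
      integral_const_mul, integral_const_mul]
  linarith

theorem expDecay_of_eventually_eq {f g : ℝ → Fin n → ℝ} (hf : ContinuousOn f (Set.Ici 0))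
    (hg : ExpDecay g) {T : ℝ} (h : ∀ t, T ≤ t → f t = g t) : ExpDecay f := by
  obtain ⟨C, c, hc, hC⟩ := hg
  obtain ⟨M, hM⟩ := (isCompact_Icc (a := (0 : ℝ)) (b := T)).exists_bound_of_continuousOn
    (hf.mono fun t ht => ht.1)
  refine ⟨max C (|M| * Real.exp (c * T)), c, hc, fun t ht => ?_⟩
  rcases le_total T t with hTt | hTt
  · rw [h t hTt]
    exact (hC t ht).trans (by gcongr; exact le_max_left _ _)
  · calc ‖f t‖ ≤ |M| := (hM t ⟨ht, hTt⟩).trans (le_abs_self M)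
      _ ≤ |M| * Real.exp (c * T) * Real.exp (-c * t) := by
          rw [mul_assoc, ← Real.exp_add]
          exact le_mul_of_one_le_right (abs_nonneg M) (Real.one_le_exp (by nlinarith))
      _ ≤ _ := by gcongr; exact le_max_right _ _

/-- The response of a stable system to a force that acts on `[0, T]` only decays exponentially. -/
theorem expDecay_forcedFlow {N : Matrix (Fin n) (Fin n) ℝ} (hN : IsHurwitz N)
    {g : ℝ → Fin n → ℝ}
    (hg : ∀ i, ∀ T : ℝ, 0 ≤ T → IntervalIntegrable (fun t => g t i) volume 0 T) {T : ℝ}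
    (hT : 0 ≤ T) (h0 : ∀ t, T < t → g t = 0) : ExpDecay (forcedFlow N 0 g) := by
  refine expDecay_of_eventually_eq (isVecPrimitive_forcedFlow N 0 hg).continuousOn
    (hN.expDecay_flow _) (T := T) (g := flow N (fun i => (0 : Fin n → ℝ) i +
      ∫ s in (0 : ℝ)..T, (NormedSpace.exp ((-s) • N) *ᵥ g s) i)) fun t ht => ?_
  rw [forcedFlow]
  congr 1
  ext i
  congr 1
  have hi := intervalIntegrable_exp_mulVec N hg i
  have h1 : ∫ s in T..t, (NormedSpace.exp ((-s) • N) *ᵥ g s) i = 0 := by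
    rw [intervalIntegral.integral_of_le ht]
    refine setIntegral_eq_zero_of_forall_eq_zero fun s hs => ?_
    rw [h0 s hs.1]; simp
  rw [← intervalIntegral.integral_add_adjacent_intervals (hi T hT)
    ((hi T hT).symm.trans (hi t (hT.trans ht))), h1, add_zero]

/-- A minimizer is `-Bᵀ p` with a solution `p` of the adjoint equation that tends to zero. -/
theorem IsMinimizer.exists_adjoint (hAB : IsStabilizable A B) (hu : IsMinimizer A B x₀ u) :
    ∃ p : ℝ → Fin n → ℝ, IsVecPrimitive p (fun t => (-Aᵀ) *ᵥ p t) ∧ Tendsto p atTop (𝓝 0) ∧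
      (fun t => (u t).ofLp) =ᵐ[volume.restrict (Set.Ici (0 : ℝ))] fun t => -(Bᵀ *ᵥ p t) := by
  obtain ⟨F, hF⟩ := hAB
  have huL := isL2_ofLp_iff.2 hu.1.1
  set M := A + B * F with hM
  -- Since `A` itself need not be stable, the adjoint equation is first solved for the stabilized
  -- matrix, as `p' = -Mᵀ p - Fᵀ u`.
  obtain ⟨p, hp, hp0⟩ := MinEnergy.exists_adjoint hF.transpose (huL.mulVec Fᵀ)
  have hpc := hp.continuousOn
  have hBp : ContinuousOn (fun t => Bᵀ *ᵥ p t) (Set.Ici 0) :=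
    (show Continuous fun y : Fin n → ℝ => Bᵀ *ᵥ y from
      continuous_const.matrix_mulVec continuous_id).comp_continuousOn hpc
  set d : ℝ → Fin m → ℝ := fun t => (u t).ofLp + Bᵀ *ᵥ p t with hd
  have hdL : ∀ T : ℝ, IsL2 (fun t => Set.indicator (Set.Icc 0 T) d t) := by
    intro T i
    have h1 : (fun t => Set.indicator (Set.Icc 0 T) d t i)
        = Set.indicator (Set.Icc 0 T) (fun t => (u t).ofLp i)
          + Set.indicator (Set.Icc 0 T) (fun t => (Bᵀ *ᵥ p t) i) := by
      funext t
      by_cases ht : t ∈ Set.Icc 0 T <;> simp [ht, hd]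
    rw [h1]
    refine MemLp.add ((huL i).indicator measurableSet_Icc) ?_
    rw [memLp_indicator_iff_restrict measurableSet_Icc,
      Measure.restrict_restrict_of_subset Set.Icc_subset_Ici_self]
    have hc : ContinuousOn (fun t => (Bᵀ *ᵥ p t) i) (Set.Icc 0 T) :=
      ((continuous_apply i).comp_continuousOn hBp).mono Set.Icc_subset_Ici_self
    obtain ⟨D, hD⟩ := isCompact_Icc.exists_bound_of_continuousOn hc
    exact MemLp.of_bound (hc.aestronglyMeasurable measurableSet_Icc) D
      ((ae_restrict_mem measurableSet_Icc).mono hD)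
  have hdi : ∀ T : ℝ, 0 ≤ T → IntervalIntegrable (fun t => d t ⬝ᵥ d t) volume 0 T := by
    intro T hT
    refine (intervalIntegrable_of_Ici ((hdL T).integrable_dotProduct (hdL T)) hT).congr ?_
    intro t ht
    rw [Set.uIoc_of_le hT] at ht
    simp [Set.indicator_of_mem (show t ∈ Set.Icc 0 T from ⟨ht.1.le, ht.2⟩)]
  have hmain : ∀ T : ℝ, 0 ≤ T → ∫ t in (0 : ℝ)..T, d t ⬝ᵥ d t = 0 := by
    intro T hT
    -- The test direction is the defect `d = u + Bᵀ p` cut off at `T`. Driving the stabilized system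
    -- from zero with `w` gives a decaying `ξ`, so `r = F ξ + w` is a legitimate variation of the
    -- control.
    set w : ℝ → Fin m → ℝ := fun t => Set.indicator (Set.Icc 0 T) d t with hw
    have hBw : ∀ i, ∀ T : ℝ, 0 ≤ T → IntervalIntegrable (fun t => (B *ᵥ w t) i) volume 0 T :=
      fun i T hT => ((hdL _).mulVec B).intervalIntegrable i T hT
    set ξ := forcedFlow M 0 (fun t => B *ᵥ w t) with hξ
    have hξp : IsVecPrimitive ξ (fun t => M *ᵥ ξ t + B *ᵥ w t) := isVecPrimitive_forcedFlow M 0 hBw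
    have hξd : ExpDecay ξ := expDecay_forcedFlow hF hBw hT fun t ht => by
      have : w t = 0 := Set.indicator_of_notMem (fun h => not_le.2 ht h.2) _
      simp [this]
    have hξL : IsL2 ξ := isL2_of_expDecay hξd hξp.continuousOn
    set r : ℝ → Fin m → ℝ := fun t => F *ᵥ ξ t + w t with hr
    have hrL : IsL2 r := (hξL.mulVec F).add (hdL T)
    have hξA : IsVecPrimitive ξ (fun t => A *ᵥ ξ t + B *ᵥ r t) := by
      have h1 : (fun t => M *ᵥ ξ t + B *ᵥ w t) = fun t => A *ᵥ ξ t + B *ᵥ r t := by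
        funext t
        simp only [hM, hr, Matrix.add_mulVec, Matrix.mulVec_add, Matrix.mulVec_mulVec, add_assoc]
      rwa [h1] at hξp
    have horth := hu.orthogonal hrL hξA (forcedFlow_zero _ _ _) hξd.tendsto
    have hprod := hp.dotProduct hξp
    -- The source term `-Fᵀ u` in the adjoint equation is chosen so that the derivative of `p ⬝ᵥ ξ`
    -- is exactly the defect term minus `u ⬝ᵥ r`.
    have hpt : ∀ t, ((-Mᵀ) *ᵥ p t + -(Fᵀ *ᵥ (u t).ofLp)) ⬝ᵥ ξ t + p t ⬝ᵥ (M *ᵥ ξ t + B *ᵥ w t)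
        = d t ⬝ᵥ w t - (u t).ofLp ⬝ᵥ r t := by
      intro t
      have e1 : (Mᵀ *ᵥ p t) ⬝ᵥ ξ t = p t ⬝ᵥ (M *ᵥ ξ t) := by
        rw [Matrix.mulVec_transpose, Matrix.dotProduct_mulVec]
      have e2 : (Fᵀ *ᵥ (u t).ofLp) ⬝ᵥ ξ t = (u t).ofLp ⬝ᵥ (F *ᵥ ξ t) := by
        rw [Matrix.mulVec_transpose, Matrix.dotProduct_mulVec]
      have e3 : (Bᵀ *ᵥ p t) ⬝ᵥ w t = p t ⬝ᵥ (B *ᵥ w t) := by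
        rw [Matrix.mulVec_transpose, Matrix.dotProduct_mulVec]
      simp only [hd, hr, add_dotProduct, dotProduct_add, Matrix.neg_mulVec, neg_dotProduct, e1, e2,
        e3]
      ring
    simp only [hpt] at hprod
    have hdw : ∀ S, T ≤ S → ∫ t in (0 : ℝ)..S, d t ⬝ᵥ w t = ∫ t in (0 : ℝ)..T, d t ⬝ᵥ d t := by
      intro S hS
      have e1 : ∀ t, d t ⬝ᵥ w t = Set.indicator (Set.Icc 0 T) (fun t => d t ⬝ᵥ d t) t := by
        intro t
        by_cases ht : t ∈ Set.Icc 0 T <;> simp [hw, ht]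
      simp only [e1]
      rw [intervalIntegral.integral_of_le (hT.trans hS), intervalIntegral.integral_of_le hT,
        setIntegral_indicator measurableSet_Icc]
      congr 2
      ext t
      simp only [Set.mem_inter_iff, Set.mem_Ioc, Set.mem_Icc]
      constructor
      · rintro ⟨⟨h1, -⟩, -, h3⟩; exact ⟨h1, h3⟩
      · rintro ⟨h1, h2⟩; exact ⟨⟨h1, h2.trans hS⟩, h1.le, h2⟩
    have hur := huL.integrable_dotProduct hrL
    have hlim1 : Tendsto (fun S => p S ⬝ᵥ ξ S) atTop (𝓝 0) := by
      have h1 := tendsto_finsetSum Finset.univ fun i (_ : i ∈ Finset.univ) =>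
        (tendsto_pi_nhds.1 hp0 i).mul (tendsto_pi_nhds.1 hξd.tendsto i)
      simpa [dotProduct] using h1
    -- The product `p ⬝ᵥ ξ` starts at zero and `u ⬝ᵥ r` integrates to zero by optimality, so its
    -- limit is the energy of the defect on `[0, T]`; this limit is also zero.
    have hlim2 : Tendsto (fun S => p S ⬝ᵥ ξ S) atTop (𝓝 (∫ t in (0 : ℝ)..T, d t ⬝ᵥ d t)) := by
      have h1 := (tendsto_integral_Ici hur).const_sub (∫ t in (0 : ℝ)..T, d t ⬝ᵥ d t)
      rw [horth, sub_zero] at h1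
      refine h1.congr' ?_
      filter_upwards [eventually_ge_atTop T] with S hS
      have hS0 := hT.trans hS
      have h2 := hprod.2 S hS0
      have h3 : IntervalIntegrable (fun t => d t ⬝ᵥ w t) volume 0 S := by
        have := (hprod.1 S hS0).add (intervalIntegrable_of_Ici hur hS0)
        exact this.congr (fun _ _ => by simp)
      have h4 : ξ 0 = 0 := forcedFlow_zero _ _ _
      beta_reduce at h2
      rw [intervalIntegral.integral_sub h3 (intervalIntegrable_of_Ici hur hS0), hdw S hS, h4,
        dotProduct_zero, zero_add] at h2
      exact h2.symm
    exact tendsto_nhds_unique hlim2 hlim1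
  have hae := ae_eq_neg_of_forall_integral_eq_zero hdi hmain
  -- Once `u = -Bᵀ p` almost everywhere, the terms with `F` cancel and the auxiliary equation
  -- becomes `p' = -Aᵀ p`.
  refine ⟨p, hp.congr_ae ?_, hp0, hae⟩
  filter_upwards [hae] with t ht
  rw [ht, hM]
  simp [Matrix.transpose_add, Matrix.transpose_mul, Matrix.neg_mulVec, Matrix.add_mulVec,
    Matrix.mulVec_neg]

/-- A minimizer is given by the feedback `-Bᵀ K x`. -/
theorem IsMinimizer.ae_eq_feedback (hAB : IsStabilizable A B) (hK : IsRiccatiSolution A B K)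
    (hu : IsMinimizer A B x₀ u) {x : ℝ → Fin n → ℝ} (hx : IsTrajectory A B x₀ u x)
    (hx0 : Tendsto x atTop (𝓝 0)) :
    (fun t => (u t).ofLp) =ᵐ[volume.restrict (Set.Ici (0 : ℝ))]
      fun t => -(Bᵀ *ᵥ (K *ᵥ x t)) := by
  obtain ⟨p, hp, hp0, hae⟩ := hu.exists_adjoint hAB
  obtain ⟨-, hxp⟩ := (isTrajectory_iff (isL2_ofLp_iff.2 hu.1.1)).1 hx
  have hKx0 : Tendsto (fun t => K *ᵥ x t) atTop (𝓝 0) := by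
    have h := ((show Continuous fun y : Fin n → ℝ => K *ᵥ y from
      continuous_const.matrix_mulVec continuous_id).tendsto 0).comp hx0
    rw [Matrix.mulVec_zero] at h
    exact h
  -- Substituting `u = -Bᵀ p` and the Riccati equation decouples the difference from `x` and leaves
  -- a homogeneous equation for it.
  have hq : IsVecPrimitive (fun t => p t - K *ᵥ x t)
      (fun t => (-(A - B * Bᵀ * K)ᵀ) *ᵥ (p t - K *ᵥ x t)) := by
    refine (hp.sub (hxp.mulVec K)).congr_ae ?_
    filter_upwards [hae] with t ht
    have hARE : K * A = K * B * Bᵀ * K - Aᵀ * K := by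
      rw [← hK.riccati]; abel
    rw [ht, Matrix.mulVec_add, Matrix.mulVec_mulVec, hARE]
    simp only [Matrix.transpose_sub, Matrix.transpose_mul, Matrix.transpose_transpose, hK.symm,
      Matrix.neg_mulVec, Matrix.sub_mulVec, Matrix.mulVec_sub, Matrix.mulVec_neg, Matrix.neg_mul,
      Matrix.sub_mul,
      Matrix.mulVec_mulVec, Matrix.mul_assoc]
    abel
  have hq0 : p 0 - K *ᵥ x 0 = 0 := by
    refine hK.eq_zero_of_tendsto ?_
    have h1 : Tendsto (fun t => p t - K *ᵥ x t) atTop (𝓝 0) := by simpa using hp0.sub hKx0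
    refine h1.congr' ?_
    filter_upwards [eventually_ge_atTop 0] with t ht using hq.eq_flow ht
  filter_upwards [hae, ae_restrict_mem measurableSet_Ici] with t ht ht0
  have h1 := hq.eq_flow ht0
  beta_reduce at h1
  rw [hq0] at h1
  have h2 : p t - K *ᵥ x t = 0 := by rw [h1]; simp [flow]
  rw [ht, sub_eq_zero.1 h2]

/-- The trajectory of a minimizer tends to zero by admissibility and is the closed-loop flow by the
feedback law. -/
theorem IsMinimizer.mem_realStable (hAB : IsStabilizable A B) (hK : IsRiccatiSolution A B K)
    (hu : IsMinimizer A B x₀ u) : x₀ ∈ realStable (A - B * Bᵀ * K) := by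
  obtain ⟨hu2, x, hx, hx0⟩ := hu.1
  have hae := hu.ae_eq_feedback hAB hK hx hx0
  rw [MinEnergy.mem_realStable]
  refine hx0.congr' ?_
  filter_upwards [eventually_ge_atTop 0] with t ht
  exact hx.congr_ae (isL2_ofLp_iff.2 hu2) hae ht

/-- The closed-loop flow decays exponentially, so the feedback is admissible and reaches the lower
bound. Any other minimizer has zero excess, hence is the same feedback of its own state, and both
states solve the same closed-loop equation from `x₀`. -/
theorem exists_isMinimizer (hK : IsRiccatiSolution A B K)
    (hx₀ : x₀ ∈ realStable (A - B * Bᵀ * K)) :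
    ∃ (u : ℝ → EuclideanSpace ℝ (Fin m)) (x : ℝ → Fin n → ℝ),
      IsMinimizer A B x₀ u ∧ energy u = x₀ ⬝ᵥ (K *ᵥ x₀) ∧ IsTrajectory A B x₀ u x ∧
      (∀ t : ℝ, 0 ≤ t → u t = WithLp.toLp 2 (-(Bᵀ *ᵥ (K *ᵥ x t)))) ∧
      ∀ v, IsMinimizer A B x₀ v → v =ᵐ[volume.restrict (Set.Ici (0 : ℝ))] u := by
  set N := A - B * Bᵀ * K with hN
  set x := flow N x₀ with hx
  set u : ℝ → EuclideanSpace ℝ (Fin m) := fun t => WithLp.toLp 2 (-(Bᵀ *ᵥ (K *ᵥ x t))) with hu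
  have hxL : IsL2 x := isL2_of_expDecay (expDecay_flow_of_mem_realStable hx₀)
    (continuous_flow N x₀).continuousOn
  have huL : IsL2 (fun t => (u t).ofLp) := fun i => (((hxL.mulVec K).mulVec Bᵀ) i).neg
  have htraj : IsTrajectory A B x₀ u x := by
    refine (isTrajectory_iff huL).2 ⟨flow_zero N x₀, ?_⟩
    have h1 : (fun t => A *ᵥ x t + B *ᵥ (u t).ofLp) = fun t => N *ᵥ flow N x₀ t := by
      funext t
      simp only [hu, hx, hN, Matrix.sub_mulVec, Matrix.mulVec_neg, ← sub_eq_add_neg,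
        Matrix.mulVec_mulVec, Matrix.mul_assoc]
    rw [h1]
    exact isVecPrimitive_flow N x₀
  have hadm : u ∈ admissible A B x₀ := ⟨isL2_ofLp_iff.1 huL, x, htraj, hx₀⟩
  have he : energy u = x₀ ⬝ᵥ (K *ᵥ x₀) := hK.energy_feedback huL htraj hx₀ fun _ _ => rfl
  have hmin : IsMinimizer A B x₀ u := ⟨hadm, fun v hv => he ▸ hK.le_energy hv⟩
  refine ⟨u, x, hmin, he, htraj, fun _ _ => rfl, fun v hv => ?_⟩
  obtain ⟨hv2, y, hy, hy0⟩ := hv.1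
  have hvL := isL2_ofLp_iff.2 hv2
  have hve : energy v = x₀ ⬝ᵥ (K *ᵥ x₀) := le_antisymm (he ▸ hv.2 u hadm) (hK.le_energy hv.1)
  have hae := hK.ae_eq_of_energy_eq hvL hy hy0 hve
  filter_upwards [hae, ae_restrict_mem measurableSet_Ici] with t ht ht0
  have hyx : y t = x t := hy.congr_ae hvL hae ht0
  ext i
  rw [ht, hyx]

end Variation

end MinEnergy

/-- The real matrix `K` and the real space `Ra` exist and do not depend on the choices made in
their definitions; the problem from `x₀` is solvable iff `x₀ ∈ Ra`; in that case the minimum is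
`x₀ᵀ K x₀`, and it is attained by the feedback control `-Bᵀ K x` and, up to a null set, only by it. -/
theorem corollary1 {n m : ℕ} (A : Matrix (Fin n) (Fin n) ℝ) (B : Matrix (Fin n) (Fin m) ℝ)
    (hAB : MinEnergy.IsStabilizable A B) :
    ∃ (K : Matrix (Fin n) (Fin n) ℝ) (Ra : Submodule ℝ (Fin n → ℝ)),
      (∀ K' : Matrix (Fin n) (Fin n) ℂ,
        MinEnergy.IsRiccatiMatrix (MinEnergy.toComplex A) (MinEnergy.toComplex B) K' ↔
          K' = MinEnergy.toComplex K) ∧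
      (∀ R : Submodule ℝ (Fin n → ℝ),
        MinEnergy.IsRealSpanOfRealBasis
            (MinEnergy.stableSubspace (MinEnergy.toComplex (A - B * B.transpose * K))) R ↔
          R = Ra) ∧
      ∀ x₀ : Fin n → ℝ,
        ((∃ u, MinEnergy.IsMinimizer A B x₀ u) ↔ x₀ ∈ Ra) ∧
        (x₀ ∈ Ra →
          ∃ (u : ℝ → EuclideanSpace ℝ (Fin m)) (x : ℝ → Fin n → ℝ),
            MinEnergy.IsMinimizer A B x₀ u ∧
            MinEnergy.energy u = dotProduct x₀ (K.mulVec x₀) ∧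
            MinEnergy.IsTrajectory A B x₀ u x ∧
            (∀ t : ℝ, 0 ≤ t →
              u t = WithLp.toLp 2 (-(B.transpose.mulVec (K.mulVec (x t))))) ∧
            ∀ v, MinEnergy.IsMinimizer A B x₀ v → v =ᵐ[volume.restrict (Set.Ici (0 : ℝ))] u) := by
  have hUC := hAB.unstableControllable
  obtain ⟨K, hK⟩ := MinEnergy.exists_real_isRiccatiMatrix hUC
  have hKs := hK.isRiccatiSolution hUC
  refine ⟨K, MinEnergy.realStable (A - B * B.transpose * K), fun K' => ?_,
    MinEnergy.isRealSpanOfRealBasis_stableSubspace_iff _, fun x₀ => ⟨⟨?_, fun hx => ?_⟩,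
      MinEnergy.exists_isMinimizer hKs⟩⟩
  · constructor
    · exact fun h => h.unique hK hUC
    · rintro rfl
      exact hK
  · rintro ⟨u, hu⟩
    exact hu.mem_realStable hAB hKs
  · obtain ⟨u, -, hu, -⟩ := MinEnergy.exists_isMinimizer hKs hx
    exact ⟨u, hu⟩
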